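/- Let $N\ge 2$, $1<p<2$, $1<q\le p$, and let $M_0,\gamma,L_a,L_b,L_f,K>0$. Write $x=(x',y)\in\mathbb R^{N-1}\times\mathbb R$, $\mathbb R^N_+=\{y>0\}$ and, for $\lambda>0$ and $y_0\ge\lambda/2$, $\Sigma_{(\lambda,y_0)}=\mathbb R^{N-1}\times(y_0-\frac\lambda2,\,y_0+\frac\lambda2)$. Let $a,b,f:\mathbb R^N_+\times\mathbb R\to\mathbb R$ be continuous functions such that (i) for every $M>0$ there are positive constants $L_a(M),L_b(M),L_f(M),K(M)$ such that for all $x\in\mathbb R^N_+$ and $s,t\in[-M,M]$ $$|a(x,s)-a(x,t)|\le L_a(M)|s-t|,\quad |b(x,s)-b(x,t)|\le L_b(M)|s-t|,\quad |f(x,s)-f(x,t)|\le L_f(M)|s-t|,$$ $$|a(x,s)|\le K(M),\qquad |b(x,s)|\le K(M),$$ and for $M=M_0$ these inequalities hold with the constants $L_a,L_b,L_f,K$; (ii) $a(x,s)\ge\gamma$ for all $(x,s)\in\mathbb R^N_+\times\mathbb R$. Then there is $\overline\lambda>0$, depending only on $N,p,q,M_0,\gamma$ and on the structural constants $L_a,L_b,L_f,K$,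 such that the following holds whenever $0<\lambda<\overline\lambda$ and $y_0\ge\lambda/2$. Let $\alpha\in(0,1)$ and let $u,v\in C^{1,\alpha}_{loc}(\overline{\Sigma_{(\lambda,y_0)}})$ satisfy $\|u\|_\infty+\|\nabla u\|_\infty\le M_0$ and $\|v\|_\infty+\|\nabla v\|_\infty\le M_0$, the norms being those of $L^\infty(\Sigma_{(\lambda,y_0)})$, and $$-\operatorname{div}(a(x,u)|\nabla u|^{p-2}\nabla u)+b(x,u)|\nabla u|^q\le f(x,u)\quad\text{in }\Sigma_{(\lambda,y_0)},$$ $$-\operatorname{div}(a(x,v)|\nabla v|^{p-2}\nabla v)+b(x,v)|\nabla v|^q\ge f(x,v)\quad\text{in }\Sigma_{(\lambda,y_0)},$$ in the weak sense, that is, tested with non-negative functions of $C^\infty_c(\Sigma_{(\lambda,y_0)})$. If $S\subseteq\Sigma_{(\lambda,y_0)}$ is open and $u\le v$ on $\partial S$, then $u\le v$ in $S$. Moreover, if the inequalities in (i) hold with the constants $L_a,L_b,L_f,K$ for all $x\in\mathbb R^N_+$ and all $s,t\in\mathbb R$ (in particular, if $a,b,f$ are globally Lipschitz continuous on $\mathbb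 R^N_+\times\mathbb R$ with Lipschitz constants $L_a,L_b,L_f$, and $|a|,|b|\le K$), then the same conclusion holds, with some $\overline\lambda>0$ depending only on the same quantities, without any assumption on the boundedness of $u$ and $v$: instead of the bounds on $u,v$ above, only $\|\nabla u\|_\infty\le M_0$ and $\|\nabla v\|_\infty\le M_0$ are required. -/

import Mathlib

open MeasureTheory

namespace StripWCP

/-- Points of `ℝ^N`, `N = n + 1`, with the Euclidean norm; `x (Fin.last n)` is the coordinate
called `y`, the other `n` coordinates form `x'`. -/
abbrev Pt (n : ℕ) : Type := EuclideanSpace ℝ (Fin (n + 1))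

/-- The open half space `ℝ^N_+ = {y > 0}`. -/
def halfSpace (n : ℕ) : Set (Pt n) := {x | 0 < x (Fin.last n)}

/-- The strip `Σ_(lam, y₀) = ℝ^(N-1) × (y₀ - lam/2, y₀ + lam/2)`. -/
def strip (n : ℕ) (lam y₀ : ℝ) : Set (Pt n) :=
  {x | x (Fin.last n) ∈ Set.Ioo (y₀ - lam / 2) (y₀ + lam / 2)}

/-- The coefficient `c = c(x, s)` is continuous on `ℝ^N_+ × ℝ`. -/
def ContCoeff {n : ℕ} (c : Pt n → ℝ → ℝ) : Prop :=
  ContinuousOn (fun z : Pt n × ℝ => c z.1 z.2) (halfSpace n ×ˢ Set.univ)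

/-- `|c(x, s) - c(x, t)| ≤ L |s - t|` for all `x ∈ ℝ^N_+` and all `s, t ∈ I`. -/
def LipInS {n : ℕ} (c : Pt n → ℝ → ℝ) (I : Set ℝ) (L : ℝ) : Prop :=
  ∀ x ∈ halfSpace n, ∀ s ∈ I, ∀ t ∈ I, |c x s - c x t| ≤ L * |s - t|

/-- `|c(x, s)| ≤ K` for all `x ∈ ℝ^N_+` and all `s ∈ I`. -/
def BddInS {n : ℕ} (c : Pt n → ℝ → ℝ) (I : Set ℝ) (K : ℝ) : Prop :=
  ∀ x ∈ halfSpace n, ∀ s ∈ I, |c x s| ≤ K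

/-- The Lipschitz and boundedness conditions on `a, b, f` for values of `s` in `I`,
with constants `La, Lb, Lf, K`. -/
structure StructOn {n : ℕ} (a b f : Pt n → ℝ → ℝ) (I : Set ℝ) (La Lb Lf K : ℝ) : Prop where
  lip_a : LipInS a I La
  lip_b : LipInS b I Lb
  lip_f : LipInS f I Lf
  bdd_a : BddInS a I K
  bdd_b : BddInS b I K

/-- `a, b, f` are locally Lipschitz in `s` uniformly in `x`, and `a, b` are locally bounded in `s`
uniformly in `x`: for every `M > 0` there are positive constants valid on `[-M, M]`. -/
def LocStruct {n : ℕ} (a b f : Pt n → ℝ → ℝ) : Prop :=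
  ∀ M : ℝ, 0 < M → ∃ La Lb Lf K : ℝ, 0 < La ∧ 0 < Lb ∧ 0 < Lf ∧ 0 < K ∧
    StructOn a b f (Set.Icc (-M) M) La Lb Lf K

/-- `a(x, s) ≥ γ` on `ℝ^N_+ × ℝ`. -/
def Elliptic {n : ℕ} (a : Pt n → ℝ → ℝ) (γ : ℝ) : Prop :=
  ∀ x ∈ halfSpace n, ∀ s : ℝ, γ ≤ a x s

/-- `u ∈ C^{1,α}_loc(closure Ω)` for an open set `Ω`: `u` is continuous on the closure,
differentiable in `Ω`, and on every compact subset of the closure the gradient is `α`-Hölder.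
The gradient is evaluated at points of `Ω` only; being uniformly continuous on bounded subsets
of `Ω`, it extends to the closure with the same Hölder constants. -/
structure C1HolderLoc {n : ℕ} (α : NNReal) (Ω : Set (Pt n)) (u : Pt n → ℝ) : Prop where
  cont : ContinuousOn u (closure Ω)
  diff : ∀ x ∈ Ω, DifferentiableAt ℝ u x
  holder : ∀ K : Set (Pt n), IsCompact K → K ⊆ closure Ω →
    ∃ C : NNReal, HolderOnWith C α (gradient u) (K ∩ Ω)

/-- Smooth non-negative test functions with compact support in `Ω`. -/
structure IsTest {n : ℕ} (Ω : Set (Pt n)) (φ : Pt n → ℝ) : Prop where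
  smooth : ContDiff ℝ ((⊤ : ℕ∞) : WithTop ℕ∞) φ
  compact : HasCompactSupport φ
  supp : tsupport φ ⊆ Ω
  nonneg : ∀ x, 0 ≤ φ x

/-- The weak form
`∫_Ω a(x,u) |∇u|^{p-2} (∇u, ∇φ) + b(x,u) |∇u|^q φ` of the left-hand side of the equation.
At critical points of `u` the first term is zero, whatever the value of `0 ^ (p - 2)`. -/
noncomputable def weakForm {n : ℕ} (p q : ℝ) (a b : Pt n → ℝ → ℝ) (Ω : Set (Pt n))
    (u φ : Pt n → ℝ) : ℝ :=
  ∫ x in Ω, (a x (u x) * ‖gradient u x‖ ^ (p - 2) * inner ℝ (gradient u x) (gradient φ x)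
    + b x (u x) * ‖gradient u x‖ ^ q * φ x)

/-- `-div(a(x,u)|∇u|^{p-2}∇u) + b(x,u)|∇u|^q ≤ f(x,u)` weakly in `Ω`. -/
def IsWeakSub {n : ℕ} (p q : ℝ) (a b f : Pt n → ℝ → ℝ) (Ω : Set (Pt n)) (u : Pt n → ℝ) : Prop :=
  ∀ φ : Pt n → ℝ, IsTest Ω φ → weakForm p q a b Ω u φ ≤ ∫ x in Ω, f x (u x) * φ x

/-- `-div(a(x,v)|∇v|^{p-2}∇v) + b(x,v)|∇v|^q ≥ f(x,v)` weakly in `Ω`. -/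
def IsWeakSuper {n : ℕ} (p q : ℝ) (a b f : Pt n → ℝ → ℝ) (Ω : Set (Pt n)) (v : Pt n → ℝ) : Prop :=
  ∀ φ : Pt n → ℝ, IsTest Ω φ → ∫ x in Ω, f x (v x) * φ x ≤ weakForm p q a b Ω v φ

/-- The norm of `L^∞(Ω)`, of a scalar or vector valued function. -/
noncomputable def supNorm {n : ℕ} {F : Type*} [NormedAddCommGroup F] (Ω : Set (Pt n))
    (g : Pt n → F) : ENNReal :=
  eLpNorm g ⊤ (volume.restrict Ω)

end StripWCP

/-! Write `N = n + 1`, `d = u - v`, and let `w = (d - ε)⁺` on `S`, extended by zero. Since `p < 2`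
and the gradients are bounded by `M`, the field `ξ ↦ ‖ξ‖ ^ (p - 2) ξ` is quadratically monotone
(`pField_sub_inner_ge`). Testing the difference of the two weak inequalities with `w ^ N η ^ m`,
where `η` is a cutoff at radius `R`, therefore controls `w ^ (N - 1) η ^ m |∇w| ^ 2` by a zero order
term `w ^ (N + 1) η ^ m` plus errors.

Narrowness of the strip enters through an exact identity instead of a Poincaré inequality:
integrating by parts against `y - y₀` gives `∫ ((y - y₀) ∂_y Ψ + Ψ) = 0` for `Ψ = w ^ (N + 1) η ^ m`
(`integral_coord_mul_fderiv_add`). Since `|y - y₀| ≤ lam / 2`, adding `Λ` times this identity with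
`Λ * lam ≤ 1` gains `Λ Ψ`, while the new gradient term keeps a coefficient independent of `Λ`. A
large `Λ` then beats every zero order term, and the whole argument becomes a pointwise inequality of
densities (`energy_density_ge`).

The strip is unbounded, and the flux difference is only of order `|∇w| ^ (p - 1)`
(`norm_pField_sub_le`), so the cutoff error is sublinear in the gradient. Linearising at the scale
`R⁻¹ η ^ (-k)` (`cutoff_error_le`) makes it a small multiple of the good terms plus a remainder `R ^
(-(N + 1))`. The choice of the power `N` in the test function is what makes this remainder beat the
volume `R ^ N` of the ball. Letting `ε → 0` for fixed `R`, then `R → ∞`, excludes a point with `u >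
v`. -/

namespace StripWCP

/-! ### Monotonicity and Hölder continuity of the `p`-Laplacian field -/

section VectorInequalities

lemma rpow_sub_one_eq {p r : ℝ} (hp : 1 < p) (hr : 0 ≤ r) : r ^ (p - 1) = r ^ (p - 2) * r := by
  rcases hr.eq_or_lt with rfl | hr
  · rw [Real.zero_rpow (by linarith), mul_zero]
  · rw [show p - 1 = (p - 2) + 1 by ring, Real.rpow_add_one hr.ne']

/-- Tangent line bound for the concave function `r ^ (p - 1)` on `[0, M]`. -/
lemma mul_sub_le_rpow_sub_rpow {p M r s : ℝ} (hp₁ : 1 < p) (hp₂ : p < 2) (hs : 0 ≤ s)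
    (hsr : s ≤ r) (hr : r ≤ M) :
    (p - 1) * M ^ (p - 2) * (r - s) ≤ r ^ (p - 1) - s ^ (p - 1) := by
  rcases hsr.eq_or_lt with rfl | hsr
  · simp
  obtain ⟨c, hc, h⟩ := exists_hasDerivAt_eq_slope (fun t : ℝ => t ^ (p - 1))
    (fun t => (p - 1) * t ^ (p - 1 - 1)) hsr
    (Real.continuous_rpow_const (by linarith)).continuousOn
    (fun t ht => Real.hasDerivAt_rpow_const (Or.inl (hs.trans_lt ht.1).ne'))
  rw [eq_div_iff (by linarith)] at h
  rw [← h, show p - 1 - 1 = p - 2 by ring]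
  have : M ^ (p - 2) ≤ c ^ (p - 2) :=
    Real.rpow_le_rpow_of_nonpos (hs.trans_lt hc.1) (hc.2.le.trans hr) (by linarith)
  have h1 : 0 ≤ p - 1 := by linarith
  have h2 : 0 ≤ r - s := by linarith
  gcongr

lemma abs_rpow_sub_rpow_le {q M r s : ℝ} (hq : 1 < q) (hr : 0 ≤ r) (hs : 0 ≤ s)
    (hrM : r ≤ M) (hsM : s ≤ M) : |r ^ q - s ^ q| ≤ q * M ^ (q - 1) * |r - s| := by
  have := (convex_Icc (0 : ℝ) M).norm_image_sub_le_of_norm_hasDerivWithin_le (𝕜 := ℝ)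
    (f := fun t : ℝ => t ^ q) (f' := fun t => q * t ^ (q - 1)) (C := q * M ^ (q - 1))
    (fun t _ => (Real.hasDerivAt_rpow_const (Or.inr hq.le)).hasDerivWithinAt)
    (fun t ht => by
      rw [Real.norm_of_nonneg (by have := Real.rpow_nonneg ht.1 (q - 1); positivity)]
      gcongr
      · exact ht.1
      · exact ht.2) ⟨hs, hsM⟩ ⟨hr, hrM⟩
  simpa [Real.norm_eq_abs] using this

variable {E : Type*} [NormedAddCommGroup E] [InnerProductSpace ℝ E]

/-- The vector field `ξ ↦ ‖ξ‖ ^ (p - 2) ξ` of the `p`-Laplacian. -/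
noncomputable def pField (p : ℝ) (ξ : E) : E := ‖ξ‖ ^ (p - 2) • ξ

lemma norm_pField {p : ℝ} (hp : 1 < p) (ξ : E) : ‖pField p ξ‖ = ‖ξ‖ ^ (p - 1) := by
  rw [pField, norm_smul, Real.norm_of_nonneg (by positivity), rpow_sub_one_eq hp (norm_nonneg _)]

/-- With `r = ‖ξ‖`, `s = ‖η‖` both sides split into a radial part and a multiple of the angular
defect `r s - ⟨ξ, η⟩ ≥ 0`. The radial part is the tangent bound times `r - s`; the angular one holds
because both weights are at least `M ^ (p - 2)` and `p - 1 ≤ 1`. -/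
lemma pField_sub_inner_ge_aux {p M : ℝ} (hp₁ : 1 < p) (hp₂ : p < 2) {ξ η : E}
    (hle : ‖η‖ ≤ ‖ξ‖) (hξ : ‖ξ‖ ≤ M) :
    (p - 1) * M ^ (p - 2) * ‖ξ - η‖ ^ 2 ≤ inner ℝ (pField p ξ - pField p η) (ξ - η) := by
  have key := mul_sub_le_rpow_sub_rpow hp₁ hp₂ (norm_nonneg η) hle hξ
  have hin : inner ℝ (pField p ξ - pField p η) (ξ - η) =
      ‖ξ‖ ^ (p - 2) * ‖ξ‖ ^ 2 + ‖η‖ ^ (p - 2) * ‖η‖ ^ 2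
        - (‖ξ‖ ^ (p - 2) + ‖η‖ ^ (p - 2)) * inner ℝ ξ η := by
    simp only [pField, inner_sub_left, inner_sub_right, inner_smul_left, real_inner_self_eq_norm_sq,
      real_inner_comm ξ η, RCLike.conj_to_real]
    ring
  rw [hin, norm_sub_sq_real]
  rw [rpow_sub_one_eq hp₁ (norm_nonneg ξ), rpow_sub_one_eq hp₁ (norm_nonneg η)] at key
  have hcs := real_inner_le_norm ξ η
  -- The case `η = 0` is separate: there `‖η‖ ^ (p - 2)` takes the value `0`, so the lower bound
  -- `hB` on the weight fails.
  rcases (norm_nonneg η).eq_or_lt with h0 | h0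
  · have hη : η = 0 := norm_eq_zero.mp h0.symm
    subst hη
    simp only [norm_zero, inner_zero_right, mul_zero, sub_zero] at key ⊢
    nlinarith [norm_nonneg ξ]
  have hξ0 := h0.trans_le hle
  have hA : M ^ (p - 2) ≤ ‖ξ‖ ^ (p - 2) := Real.rpow_le_rpow_of_nonpos hξ0 hξ (by linarith)
  have hB : M ^ (p - 2) ≤ ‖η‖ ^ (p - 2) :=
    Real.rpow_le_rpow_of_nonpos h0 (hle.trans hξ) (by linarith)
  have hM : 0 ≤ M ^ (p - 2) := Real.rpow_nonneg (hξ0.le.trans hξ) _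
  set A := ‖ξ‖ ^ (p - 2)
  set B := ‖η‖ ^ (p - 2)
  set c := M ^ (p - 2)
  have hc : (p - 1) * c ≤ c := by nlinarith
  have h1 : 0 ≤ (A + B - 2 * ((p - 1) * c)) * (‖ξ‖ * ‖η‖ - inner ℝ ξ η) :=
    mul_nonneg (by linarith) (by linarith)
  have h2 := mul_le_mul_of_nonneg_right key (sub_nonneg.mpr hle)
  nlinarith

lemma pField_sub_inner_ge {p M : ℝ} (hp₁ : 1 < p) (hp₂ : p < 2) {ξ η : E}
    (hξ : ‖ξ‖ ≤ M) (hη : ‖η‖ ≤ M) :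
    (p - 1) * M ^ (p - 2) * ‖ξ - η‖ ^ 2 ≤ inner ℝ (pField p ξ - pField p η) (ξ - η) := by
  rcases le_total ‖η‖ ‖ξ‖ with h | h
  · exact pField_sub_inner_ge_aux hp₁ hp₂ h hξ
  · have := pField_sub_inner_ge_aux hp₁ hp₂ h hη
    rwa [norm_sub_rev, ← neg_sub (pField p ξ), ← neg_sub ξ η, inner_neg_neg] at this

/-- If `‖ξ - η‖` exceeds the larger norm, the triangle inequality suffices. Otherwise the change of
the weight `‖·‖ ^ (p - 2)`, multiplied by `‖η‖`, is controlled by monotonicity of `r ^ (p - 1)`. -/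
lemma norm_pField_sub_le_aux {p : ℝ} (hp₁ : 1 < p) (hp₂ : p < 2) {ξ η : E} (hle : ‖η‖ ≤ ‖ξ‖) :
    ‖pField p ξ - pField p η‖ ≤ 2 * ‖ξ - η‖ ^ (p - 1) := by
  have hp : 0 ≤ p - 1 := by linarith
  rcases le_total ‖ξ‖ ‖ξ - η‖ with h | h
  · calc ‖pField p ξ - pField p η‖ ≤ ‖pField p ξ‖ + ‖pField p η‖ := norm_sub_le _ _
      _ = ‖ξ‖ ^ (p - 1) + ‖η‖ ^ (p - 1) := by rw [norm_pField hp₁, norm_pField hp₁]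
      _ ≤ ‖ξ - η‖ ^ (p - 1) + ‖ξ - η‖ ^ (p - 1) := by
          have := hle.trans h
          gcongr
      _ = _ := by ring
  rcases (norm_nonneg (ξ - η)).eq_or_lt with h0 | h0
  · have : ξ = η := sub_eq_zero.mp (norm_eq_zero.mp h0.symm)
    subst this
    simp only [sub_self, norm_zero]
    positivity
  have hmono : ‖η‖ ^ (p - 1) ≤ ‖ξ‖ ^ (p - 1) := by gcongr
  have hA : ‖ξ‖ ^ (p - 2) ≤ ‖ξ - η‖ ^ (p - 2) := Real.rpow_le_rpow_of_nonpos h0 h (by linarith)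
  have hsub : ‖ξ‖ - ‖η‖ ≤ ‖ξ - η‖ := norm_sub_norm_le ξ η
  have hAnn : 0 ≤ ‖ξ‖ ^ (p - 2) := by positivity
  have hdec : pField p ξ - pField p η =
      ‖ξ‖ ^ (p - 2) • (ξ - η) + (‖ξ‖ ^ (p - 2) - ‖η‖ ^ (p - 2)) • η := by
    simp only [pField, smul_sub, sub_smul]
    abel
  have h2 : |‖ξ‖ ^ (p - 2) - ‖η‖ ^ (p - 2)| * ‖η‖ ≤ ‖ξ‖ ^ (p - 2) * ‖ξ - η‖ := by
    rcases (norm_nonneg η).eq_or_lt with hz | hz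
    · rw [← hz, mul_zero]; positivity
    have : ‖ξ‖ ^ (p - 2) ≤ ‖η‖ ^ (p - 2) := Real.rpow_le_rpow_of_nonpos hz hle (by linarith)
    rw [abs_of_nonpos (by linarith)]
    rw [rpow_sub_one_eq hp₁ (norm_nonneg _), rpow_sub_one_eq hp₁ (norm_nonneg _)] at hmono
    nlinarith [mul_le_mul_of_nonneg_left hsub hAnn]
  calc ‖pField p ξ - pField p η‖
      ≤ ‖ξ‖ ^ (p - 2) * ‖ξ - η‖ + |‖ξ‖ ^ (p - 2) - ‖η‖ ^ (p - 2)| * ‖η‖ := by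
        rw [hdec]
        refine (norm_add_le _ _).trans_eq ?_
        rw [norm_smul, norm_smul, Real.norm_of_nonneg hAnn, Real.norm_eq_abs]
    _ ≤ 2 * (‖ξ - η‖ ^ (p - 2) * ‖ξ - η‖) := by
        have := mul_le_mul_of_nonneg_right hA (norm_nonneg (ξ - η))
        linarith
    _ = _ := by rw [← rpow_sub_one_eq hp₁ (norm_nonneg _)]

lemma norm_pField_sub_le {p : ℝ} (hp₁ : 1 < p) (hp₂ : p < 2) (ξ η : E) :
    ‖pField p ξ - pField p η‖ ≤ 2 * ‖ξ - η‖ ^ (p - 1) := by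
  rcases le_total ‖η‖ ‖ξ‖ with h | h
  · exact norm_pField_sub_le_aux hp₁ hp₂ h
  · rw [norm_sub_rev, norm_sub_rev ξ]
    exact norm_pField_sub_le_aux hp₁ hp₂ h

lemma continuous_pField {p : ℝ} (hp₁ : 1 < p) (hp₂ : p < 2) : Continuous (pField p : E → E) := by
  rw [continuous_iff_continuousAt]
  intro η
  rw [ContinuousAt, tendsto_iff_norm_sub_tendsto_zero]
  refine squeeze_zero (fun _ => norm_nonneg _) (fun ξ => norm_pField_sub_le hp₁ hp₂ ξ η) ?_
  have : Continuous fun ξ : E => 2 * ‖ξ - η‖ ^ (p - 1) :=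
    continuous_const.mul ((continuous_id.sub continuous_const).norm.rpow_const
      fun _ => Or.inr (by linarith))
  have h := this.tendsto η
  simpa [Real.zero_rpow (show p - 1 ≠ 0 by linarith)] using h

end VectorInequalities

/-! ### Smoothing of `C¹` test functions -/

section Mollification

open ContinuousLinearMap Metric

variable {E : Type*} [NormedAddCommGroup E] [NormedSpace ℝ E] [FiniteDimensional ℝ E]
  [MeasurableSpace E] [BorelSpace E]

/-- Non-negative compactly supported `C¹` functions are approximated in `C¹` by non-negative smooth
functions with almost the same support. -/
lemma exists_smooth_C1_approx {ψ : E → ℝ} (hψ : ContDiff ℝ 1 ψ) (hc : HasCompactSupport ψ)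
    (h0 : ∀ x, 0 ≤ ψ x) {δ ε : ℝ} (hδ : 0 < δ) (hε : 0 < ε) :
    ∃ φ : E → ℝ, ContDiff ℝ ((⊤ : ℕ∞) : WithTop ℕ∞) φ ∧ (∀ x, 0 ≤ φ x) ∧
      tsupport φ ⊆ cthickening δ (tsupport ψ) ∧ (∀ x, |φ x - ψ x| ≤ ε) ∧
      ∀ x, ‖fderiv ℝ φ x - fderiv ℝ ψ x‖ ≤ ε := by
  let μ : Measure E := Measure.addHaar
  have hdc : Continuous (fderiv ℝ ψ) := hψ.continuous_fderiv one_ne_zero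
  obtain ⟨δ₁, hδ₁, h₁⟩ := Metric.uniformContinuous_iff.mp
    (hc.uniformContinuous_of_continuous hψ.continuous) ε hε
  obtain ⟨δ₂, hδ₂, h₂⟩ := Metric.uniformContinuous_iff.mp
    ((hc.fderiv ℝ).uniformContinuous_of_continuous hdc) ε hε
  obtain ⟨r, hr, hrδ⟩ : ∃ r, 0 < r ∧ r ≤ δ ∧ r ≤ δ₁ ∧ r ≤ δ₂ :=
    ⟨min δ (min δ₁ δ₂), by positivity, min_le_left _ _,
      (min_le_right _ _).trans (min_le_left _ _), (min_le_right _ _).trans (min_le_right _ _)⟩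
  let ρ : ContDiffBump (0 : E) := ⟨r / 2, r, half_pos hr, half_lt_self hr⟩
  have hsm : ∀ x, ∀ t : ℝ, (∀ y ∈ ball x r, dist (ψ y) (ψ x) ≤ t) →
      dist ((convolution (ρ.normed μ) ψ (lsmul ℝ ℝ) μ) x) (ψ x) ≤ t := fun x t h =>
    ρ.dist_normed_convolution_le hψ.continuous.aestronglyMeasurable h
  refine ⟨convolution (ρ.normed μ) ψ (lsmul ℝ ℝ) μ, ?_, ?_, ?_, ?_, ?_⟩
  · exact ρ.hasCompactSupport_normed.contDiff_convolution_left _ ρ.contDiff_normed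
      hψ.continuous.locallyIntegrable
  · intro x
    exact integral_nonneg fun t => mul_nonneg (ρ.nonneg_normed t) (h0 _)
  · refine closure_minimal ?_ isClosed_cthickening
    intro x hx
    by_contra hxn
    apply hx
    have hz : ∀ y ∈ ball x r, ψ y = 0 := by
      intro y hy
      by_contra hy0
      refine hxn (mem_cthickening_of_dist_le x y δ _ (subset_tsupport _ hy0) ?_)
      rw [dist_comm]
      exact (mem_ball.mp hy).le.trans hrδ.1
    have hx0 := hz x (mem_ball_self hr)
    -- Tolerance zero: where `ψ` vanishes on the whole ball, so does the average.
    have := hsm x 0 fun y hy => by rw [hz y hy, hx0, dist_self]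
    rw [hx0] at this
    exact dist_le_zero.mp this
  · intro x
    exact hsm x ε fun y hy => (h₁ ((mem_ball.mp hy).trans_le hrδ.2.1)).le
  · intro x
    have hd := hc.hasFDerivAt_convolution_right (lsmul ℝ ℝ) (μ := μ) (f := ρ.normed μ)
      (ρ.continuous_normed.locallyIntegrable) hψ x
    have heq : convolution (ρ.normed μ) (fderiv ℝ ψ) ((lsmul ℝ ℝ).precompR E) μ x =
        convolution (ρ.normed μ) (fderiv ℝ ψ) (lsmul ℝ ℝ) μ x := by
      refine integral_congr_ae (Filter.Eventually.of_forall fun t => ?_)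
      ext v
      simp [precompR_apply]
    rw [hd.fderiv, heq, ← dist_eq_norm]
    exact ρ.dist_normed_convolution_le hdc.aestronglyMeasurable
      fun y hy => (h₂ ((mem_ball.mp hy).trans_le hrδ.2.2)).le

end Mollification

/-! ### Passage from smooth to `C¹` test functions -/

section TestFunctions

open Metric

lemma integrable_of_continuousOn_of_forall_notMem_eq_zero {X : Type*} [TopologicalSpace X]
    [T2Space X] [MeasurableSpace X] [OpensMeasurableSpace X] {μ : Measure X}
    [IsFiniteMeasureOnCompacts μ] {g : X → ℝ} {s : Set X} (hs : IsCompact s)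
    (hg : ContinuousOn g s) (h0 : ∀ x ∉ s, g x = 0) : Integrable g μ := by
  rw [← integrableOn_iff_integrable_of_support_subset (s := s)]
  · exact hg.integrableOn_compact hs
  · intro x hx
    by_contra h
    exact hx (h0 x h)

variable {n : ℕ}

lemma gradient_eq_zero_of_notMem_tsupport {φ : Pt n → ℝ} {x : Pt n} (hx : x ∉ tsupport φ) :
    gradient φ x = 0 := by
  have : fderiv ℝ φ x = 0 := image_eq_zero_of_notMem_tsupport
    fun h => hx (tsupport_fderiv_subset ℝ h)
  rw [gradient, this, map_zero]

lemma norm_gradient_sub {φ ψ : Pt n → ℝ} (x : Pt n) :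
    ‖gradient φ x - gradient ψ x‖ = ‖fderiv ℝ φ x - fderiv ℝ ψ x‖ := by
  rw [gradient, gradient, ← map_sub, LinearIsometryEquiv.norm_map]

lemma continuous_gradient {φ : Pt n → ℝ} (hφ : ContDiff ℝ 1 φ) : Continuous (gradient φ) :=
  (InnerProductSpace.toDual ℝ (Pt n)).symm.continuous.comp (hφ.continuous_fderiv one_ne_zero)

lemma integrable_test {Ω : Set (Pt n)} {H : Pt n → Pt n} {G : Pt n → ℝ}
    (hH : ContinuousOn H Ω) (hG : ContinuousOn G Ω) {ψ : Pt n → ℝ} (hψ : ContDiff ℝ 1 ψ)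
    (hc : HasCompactSupport ψ) (hs : tsupport ψ ⊆ Ω) :
    Integrable (fun x => inner ℝ (H x) (gradient ψ x) + G x * ψ x) := by
  refine integrable_of_continuousOn_of_forall_notMem_eq_zero hc ?_ fun x hx => ?_
  · exact ((hH.mono hs).inner (continuous_gradient hψ).continuousOn).add
      ((hG.mono hs).mul hψ.continuous.continuousOn)
  · rw [gradient_eq_zero_of_notMem_tsupport hx, image_eq_zero_of_notMem_tsupport hx]
    simp

/-- A weak differential inequality with continuous coefficients, valid for smooth test functions,
holds for `C¹` test functions. -/
lemma integral_test_nonpos_of_C1 {Ω : Set (Pt n)} (hΩ : IsOpen Ω) {H : Pt n → Pt n}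
    {G : Pt n → ℝ} (hH : ContinuousOn H Ω) (hG : ContinuousOn G Ω)
    (h : ∀ φ, IsTest Ω φ → ∫ x, (inner ℝ (H x) (gradient φ x) + G x * φ x) ≤ 0)
    {ψ : Pt n → ℝ} (hψ : ContDiff ℝ 1 ψ) (hc : HasCompactSupport ψ) (hs : tsupport ψ ⊆ Ω)
    (h0 : ∀ x, 0 ≤ ψ x) :
    ∫ x, (inner ℝ (H x) (gradient ψ x) + G x * ψ x) ≤ 0 := by
  obtain ⟨δ, hδ, hsub⟩ := hc.isCompact.exists_cthickening_subset_open hΩ hs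
  set K := cthickening δ (tsupport ψ)
  have hK : IsCompact K := hc.isCompact.cthickening
  obtain ⟨C₁, hC₁⟩ := hK.exists_bound_of_continuousOn (hH.mono hsub)
  obtain ⟨C₂, hC₂⟩ := hK.exists_bound_of_continuousOn (hG.mono hsub)
  set C := |C₁| + |C₂|
  refine le_of_forall_pos_le_add fun ε hε => ?_
  have hV : 0 ≤ (volume K).toReal := ENNReal.toReal_nonneg
  set V := (volume K).toReal
  -- An error `t` in `φ` and its gradient costs at most `C * t` on `K`, hence `C * V * t ≤ ε` in
  -- total; the `+ 1` guards against `C * V = 0`.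
  obtain ⟨φ, hφ, hφ0, hφs, hφψ, hdφψ⟩ := exists_smooth_C1_approx hψ hc h0 hδ
    (show 0 < ε / (C * V + 1) by positivity)
  set t := ε / (C * V + 1)
  have hφc : HasCompactSupport φ := hK.of_isClosed_subset (isClosed_tsupport φ) hφs
  have hφ1 : ContDiff ℝ 1 φ := hφ.of_le (by exact_mod_cast le_top)
  have ht := h φ ⟨hφ, hφc, hφs.trans hsub, hφ0⟩
  have iφ := integrable_test hH hG hφ1 hφc (hφs.trans hsub)
  have iψ := integrable_test hH hG hψ hc hs
  have hcomp : ∀ x, inner ℝ (H x) (gradient ψ x) + G x * ψ x ≤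
      inner ℝ (H x) (gradient φ x) + G x * φ x + K.indicator (fun _ => C * t) x := by
    intro x
    by_cases hx : x ∈ K
    · rw [Set.indicator_of_mem hx]
      have e1 : inner ℝ (H x) (gradient ψ x) - inner ℝ (H x) (gradient φ x) ≤ |C₁| * t := by
        rw [← inner_sub_right]
        refine (real_inner_le_norm _ _).trans ?_
        rw [norm_sub_rev, norm_gradient_sub]
        exact mul_le_mul ((hC₁ x hx).trans (le_abs_self _)) (hdφψ x) (norm_nonneg _) (abs_nonneg _)
      have e2 : G x * ψ x - G x * φ x ≤ |C₂| * t := by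
        rw [← mul_sub]
        refine (le_abs_self _).trans ?_
        rw [abs_mul, abs_sub_comm]
        exact mul_le_mul ((hC₂ x hx).trans (le_abs_self _)) (hφψ x) (abs_nonneg _) (abs_nonneg _)
      have : C * t = |C₁| * t + |C₂| * t := add_mul _ _ _
      linarith
    · rw [Set.indicator_of_notMem hx, gradient_eq_zero_of_notMem_tsupport fun h => hx (hφs h),
        image_eq_zero_of_notMem_tsupport fun h => hx (hφs h),
        gradient_eq_zero_of_notMem_tsupport fun h => hx (self_subset_cthickening _ h),
        image_eq_zero_of_notMem_tsupport fun h => hx (self_subset_cthickening _ h)]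
      simp
  have iC : Integrable (K.indicator fun _ => C * t) (volume : Measure (Pt n)) :=
    (integrable_indicator_iff hK.measurableSet).mpr
      (integrableOn_const hK.measure_lt_top.ne)
  calc _ ≤ ∫ x, (inner ℝ (H x) (gradient φ x) + G x * φ x + K.indicator (fun _ => C * t) x) :=
        integral_mono iψ (iφ.add iC) hcomp
    _ = (∫ x, (inner ℝ (H x) (gradient φ x) + G x * φ x)) + V * (C * t) := by
        rw [integral_add iφ iC, integral_indicator hK.measurableSet, setIntegral_const]
        rfl
    _ ≤ 0 + ε := by
        refine add_le_add ht ?_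
        have hCV : 0 < C * V + 1 := by positivity
        have : t * (C * V + 1) = ε := div_mul_cancel₀ _ hCV.ne'
        have ht0 : 0 ≤ t := by positivity
        nlinarith

end TestFunctions

/-! ### Powers of the truncated difference are `C¹` -/

section Truncation

open Filter Topology

/-- An exponent of at least two removes the kink: at `0` the function is `O(s ^ (k + 2))`, hence
`o(s)`. -/
lemma hasDerivAt_max_zero_pow (k : ℕ) (t : ℝ) :
    HasDerivAt (fun s : ℝ => max s 0 ^ (k + 2)) ((k + 2) * max t 0 ^ (k + 1)) t := by
  rcases lt_trichotomy t 0 with ht | rfl | ht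
  · rw [max_eq_right ht.le, zero_pow (by omega), mul_zero]
    refine (hasDerivAt_const t (0 : ℝ)).congr_of_eventuallyEq ?_
    filter_upwards [gt_mem_nhds ht] with s hs
    rw [max_eq_right (le_of_lt hs), zero_pow (by omega)]
  · rw [max_self, zero_pow (by omega), mul_zero]
    have hb : (fun s : ℝ => max s 0 ^ (k + 2)) =O[𝓝 0] fun s => s ^ (k + 2) := by
      refine Asymptotics.IsBigO.of_bound 1 (Eventually.of_forall fun s => ?_)
      rw [one_mul, norm_pow, norm_pow]
      refine pow_le_pow_left₀ (norm_nonneg _) ?_ _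
      rw [Real.norm_of_nonneg (le_max_right _ _), Real.norm_eq_abs]
      exact max_le (le_abs_self s) (abs_nonneg s)
    have h := hb.trans_isLittleO
      (Asymptotics.isLittleO_pow_pow (𝕜 := ℝ) (show 1 < k + 2 by omega))
    rw [hasDerivAt_iff_isLittleO]
    simpa using h
  · have h := (hasDerivAt_pow (k + 2) t).congr_of_eventuallyEq
      (f₁ := fun s : ℝ => max s 0 ^ (k + 2)) (by
        filter_upwards [lt_mem_nhds ht] with s hs
        rw [max_eq_left (le_of_lt hs)])
    rw [max_eq_left ht.le]
    have hcast : ((k + 2 : ℕ) : ℝ) = k + 2 := by push_cast; ring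
    rwa [hcast] at h

variable {E : Type*}

/-- The truncation `(d - ε)⁺` on `S`, extended by zero. -/
noncomputable def trunc (S : Set E) (d : E → ℝ) (ε : ℝ) : E → ℝ :=
  S.indicator fun x => max (d x - ε) 0

/-- The set where `trunc S d ε` is positive. -/
def truncSet (S : Set E) (d : E → ℝ) (ε : ℝ) : Set E := {x ∈ S | ε < d x}

variable {S : Set E} {d : E → ℝ} {ε : ℝ}

lemma trunc_nonneg (x : E) : 0 ≤ trunc S d ε x :=
  Set.indicator_nonneg (fun _ _ => le_max_right _ _) x

lemma trunc_of_mem {x : E} (hx : x ∈ truncSet S d ε) : trunc S d ε x = d x - ε := by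
  rw [trunc, Set.indicator_of_mem hx.1, max_eq_left (by linarith [hx.2])]

lemma trunc_of_notMem {x : E} (hx : x ∉ truncSet S d ε) : trunc S d ε x = 0 := by
  by_cases hS : x ∈ S
  · rw [trunc, Set.indicator_of_mem hS, max_eq_right]
    have : ¬ ε < d x := fun h => hx ⟨hS, h⟩
    linarith
  · rw [trunc, Set.indicator_of_notMem hS]

variable [NormedAddCommGroup E]

/-- A limit point has `d ≥ ε > 0`, whereas `d ≤ 0` on the frontier. Truncating at `ε > 0` thus makes
the extension by zero regular without any regularity of `∂S` or of `d` beyond continuity there. -/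
lemma closure_truncSet_subset (hdc : ContinuousOn d (closure S))
    (hfr : ∀ x ∈ frontier S, d x ≤ 0) (hε : 0 < ε) : closure (truncSet S d ε) ⊆ S := by
  intro x hx
  have hxS : x ∈ closure S := closure_mono (fun _ h => h.1) hx
  by_contra hn
  have hle := hfr x ⟨hxS, fun h => hn (interior_subset h)⟩
  have hge : ε ≤ d x := by
    have hne : (𝓝[truncSet S d ε] x).NeBot := mem_closure_iff_nhdsWithin_neBot.mp hx
    have hsub : truncSet S d ε ⊆ closure S := fun _ h => subset_closure h.1
    refine ge_of_tendsto ((hdc x hxS).mono_left (nhdsWithin_mono x hsub)) ?_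
    filter_upwards [self_mem_nhdsWithin] with y hy using hy.2.le
  linarith

lemma trunc_eventuallyEq_zero {x : E} (hx : x ∉ closure (truncSet S d ε)) :
    trunc S d ε =ᶠ[𝓝 x] fun _ => 0 := by
  filter_upwards [isClosed_closure.isOpen_compl.mem_nhds hx] with y hy
  exact trunc_of_notMem fun h => hy (subset_closure h)

lemma trunc_eventuallyEq {x : E} (hS : IsOpen S) (hx : x ∈ S) :
    trunc S d ε =ᶠ[𝓝 x] fun y => max (d y - ε) 0 := by
  filter_upwards [hS.mem_nhds hx] with y hy
  rw [trunc, Set.indicator_of_mem hy]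

lemma continuous_trunc (hS : IsOpen S) (hdc : ContinuousOn d (closure S))
    (hfr : ∀ x ∈ frontier S, d x ≤ 0) (hε : 0 < ε) : Continuous (trunc S d ε) := by
  rw [continuous_iff_continuousAt]
  intro x
  by_cases hx : x ∈ S
  · have h : ContinuousAt d x :=
      hdc.continuousAt (mem_of_superset (hS.mem_nhds hx) subset_closure)
    exact ContinuousAt.congr ((h.sub continuousAt_const).max continuousAt_const)
      (trunc_eventuallyEq hS hx).symm
  · exact ContinuousAt.congr continuousAt_const (trunc_eventuallyEq_zero
      fun h => hx (closure_truncSet_subset hdc hfr hε h)).symm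

variable [NormedSpace ℝ E]

lemma hasFDerivAt_trunc_pow (hS : IsOpen S) (hdc : ContinuousOn d (closure S))
    (hfr : ∀ x ∈ frontier S, d x ≤ 0) (hε : 0 < ε) (hd : ∀ x ∈ S, DifferentiableAt ℝ d x)
    (k : ℕ) (x : E) :
    HasFDerivAt (fun y => trunc S d ε y ^ (k + 2))
      (((k + 2) * trunc S d ε x ^ (k + 1)) • fderiv ℝ d x) x := by
  by_cases hx : x ∈ S
  · have h := (hasDerivAt_max_zero_pow k (d x - ε)).comp_hasFDerivAt x
      ((hd x hx).hasFDerivAt.sub_const ε)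
    have he := trunc_eventuallyEq (ε := ε) (d := d) hS hx
    rw [he.eq_of_nhds]
    refine h.congr_of_eventuallyEq ?_
    filter_upwards [he] with y hy
    rw [hy]
    rfl
  · have he := trunc_eventuallyEq_zero
      fun h => hx (closure_truncSet_subset hdc hfr hε h)
    rw [he.eq_of_nhds, zero_pow (by omega), mul_zero, zero_smul]
    refine (hasFDerivAt_const (0 : ℝ) x).congr_of_eventuallyEq ?_
    filter_upwards [he] with y hy
    rw [hy, zero_pow (by omega)]

lemma contDiff_trunc_pow (hS : IsOpen S) (hdc : ContinuousOn d (closure S))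
    (hfr : ∀ x ∈ frontier S, d x ≤ 0) (hε : 0 < ε) (hd : ∀ x ∈ S, DifferentiableAt ℝ d x)
    (hdf : ContinuousOn (fderiv ℝ d) S) (k : ℕ) :
    ContDiff ℝ 1 (fun y => trunc S d ε y ^ (k + 2)) := by
  have hder := hasFDerivAt_trunc_pow hS hdc hfr hε hd k
  rw [contDiff_one_iff_fderiv]
  refine ⟨fun x => (hder x).differentiableAt, ?_⟩
  rw [show fderiv ℝ (fun y => trunc S d ε y ^ (k + 2)) =
    fun x => ((k + 2) * trunc S d ε x ^ (k + 1)) • fderiv ℝ d x from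
      funext fun x => (hder x).fderiv, continuous_iff_continuousAt]
  intro x
  by_cases hx : x ∈ S
  · exact (continuousAt_const.mul
      ((continuous_trunc hS hdc hfr hε).continuousAt.pow _)).smul
      (hdf.continuousAt (hS.mem_nhds hx))
  · have he := trunc_eventuallyEq_zero
      fun h => hx (closure_truncSet_subset hdc hfr hε h)
    refine (continuousAt_const (y := 0)).congr ?_
    filter_upwards [he] with y hy
    rw [hy, zero_pow (by omega), mul_zero, zero_smul]

end Truncation

/-! ### Cutoffs at scale `R` -/

section Cutoff

open Metric

/-- Dilations of one fixed bump, so `C` does not depend on `R`. -/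
lemma exists_cutoff (E : Type*) [NormedAddCommGroup E] [InnerProductSpace ℝ E]
    [FiniteDimensional ℝ E] :
    ∃ C : ℝ, 0 ≤ C ∧ ∀ R : ℝ, 0 < R → ∃ η : E → ℝ, ContDiff ℝ 1 η ∧ (∀ x, 0 ≤ η x) ∧
      (∀ x, η x ≤ 1) ∧ (∀ x ∈ ball (0 : E) R, η x = 1) ∧ tsupport η ⊆ closedBall 0 (2 * R) ∧
      ∀ x, ‖fderiv ℝ η x‖ ≤ C / R := by
  let b : ContDiffBump (0 : E) := ⟨1, 2, one_pos, one_lt_two⟩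
  have hb : ContDiff ℝ 1 b := b.contDiff
  obtain ⟨C, hC⟩ := (b.hasCompactSupport.fderiv ℝ).exists_bound_of_continuous
    (hb.continuous_fderiv one_ne_zero)
  refine ⟨C, (norm_nonneg _).trans (hC 0), fun R hR => ⟨fun x => b (R⁻¹ • x),
    hb.comp (contDiff_const_smul _), fun x => b.nonneg, fun x => b.le_one, fun x hx => ?_, ?_,
    fun x => ?_⟩⟩
  · refine b.one_of_mem_closedBall ?_
    rw [mem_closedBall_zero_iff, norm_smul, norm_inv, Real.norm_of_nonneg hR.le]
    rw [mem_ball_zero_iff] at hx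
    exact inv_mul_le_one_of_le₀ hx.le hR.le
  · refine closure_minimal (fun x hx => ?_) isClosed_closedBall
    have h : R⁻¹ • x ∈ Function.support b := hx
    rw [b.support_eq, mem_ball_zero_iff, norm_smul, norm_inv, Real.norm_of_nonneg hR.le,
      inv_mul_lt_iff₀ hR] at h
    rw [mem_closedBall_zero_iff]
    change ‖x‖ < R * 2 at h
    linarith
  · have h := ((hb.differentiable one_ne_zero (R⁻¹ • x)).hasFDerivAt).comp x
      ((hasFDerivAt_id x).const_smul R⁻¹)
    have h' : HasFDerivAt (fun x => b (R⁻¹ • x)) _ x := h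
    rw [h'.fderiv]
    have : (fderiv ℝ b (R⁻¹ • x)).comp (R⁻¹ • ContinuousLinearMap.id ℝ E) =
        R⁻¹ • fderiv ℝ b (R⁻¹ • x) := by
      ext v; simp
    rw [this, norm_smul, norm_inv, Real.norm_of_nonneg hR.le, div_eq_inv_mul]
    have := hC (R⁻¹ • x)
    gcongr

end Cutoff

/-! ### The identity replacing the Poincaré inequality -/

section IntegrationByParts

variable {n : ℕ}

/-- Integration by parts against `x i - y₀`, whose derivative along the `i`-th axis is `1`. For `Ψ`
supported in the strip and `i` the last index, the weight is at most `lam / 2`. -/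
lemma integral_coord_mul_fderiv_add {Ψ : Pt n → ℝ} (hΨ : ContDiff ℝ 1 Ψ)
    (hc : HasCompactSupport Ψ) (i : Fin (n + 1)) (y₀ : ℝ) :
    ∫ x : Pt n, ((x i - y₀) * fderiv ℝ Ψ x (EuclideanSpace.single i 1) + Ψ x) = 0 := by
  set e : Pt n := EuclideanSpace.single i 1
  let L : Pt n →L[ℝ] ℝ := EuclideanSpace.proj i
  have hf : ∀ x : Pt n, HasFDerivAt (fun x : Pt n => x i - y₀) L x := fun x =>
    L.hasFDerivAt.sub_const y₀
  have hLe : L e = 1 := by simp [L, e]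
  have hcoord : Continuous fun x : Pt n => x i - y₀ := L.continuous.sub continuous_const
  have hdΨ : Continuous fun x => fderiv ℝ Ψ x e :=
    (hΨ.continuous_fderiv one_ne_zero).clm_apply continuous_const
  have i0 : Integrable Ψ := hΨ.continuous.integrable_of_hasCompactSupport hc
  have i1 : Integrable fun x => (x i - y₀) * fderiv ℝ Ψ x e :=
    (hcoord.mul hdΨ).integrable_of_hasCompactSupport
      ((hc.fderiv_apply ℝ e).mul_left)
  have i2 : Integrable fun x => (x i - y₀) * Ψ x :=
    (hcoord.mul hΨ.continuous).integrable_of_hasCompactSupport hc.mul_left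
  have hfd : (fun x : Pt n => fderiv ℝ (fun x : Pt n => x i - y₀) x e * Ψ x) = Ψ := by
    funext x
    rw [(hf x).fderiv, hLe, one_mul]
  have h := integral_mul_fderiv_eq_neg_fderiv_mul_of_integrable (μ := (volume : Measure (Pt n)))
    (f := fun x : Pt n => x i - y₀) (g := Ψ) (v := e) (by rw [hfd]; exact i0) i1 i2
    (fun x _ => (hf x).differentiableAt) (fun x _ => hΨ.differentiable one_ne_zero x)
  rw [hfd] at h
  rw [integral_add i1 i0, h, neg_add_cancel]

end IntegrationByParts

/-! ### Structure conditions applied to differences, with `D` standing for `|u - v|` -/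

section Coefficients

variable {E : Type*} [NormedAddCommGroup E] [InnerProductSpace ℝ E]

/-- The difference splits as `a₁` times the difference of the fields, which is coercive, plus `a₁ -
a₂` times a bounded field, which is a Lipschitz error. -/
lemma inner_flux_sub_ge {p M γ L D a₁ a₂ : ℝ} (hp₁ : 1 < p) (hp₂ : p < 2) {ξ ζ : E}
    (hξ : ‖ξ‖ ≤ M) (hζ : ‖ζ‖ ≤ M) (hγ : 0 ≤ γ) (ha : γ ≤ a₁) (hd : |a₁ - a₂| ≤ L * D) :
    γ * ((p - 1) * M ^ (p - 2)) * ‖ξ - ζ‖ ^ 2 - L * M ^ (p - 1) * D * ‖ξ - ζ‖ ≤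
      inner ℝ (a₁ • pField p ξ - a₂ • pField p ζ) (ξ - ζ) := by
  have h1 := pField_sub_inner_ge hp₁ hp₂ hξ hζ
  have hdec : a₁ • pField p ξ - a₂ • pField p ζ =
      a₁ • (pField p ξ - pField p ζ) + (a₁ - a₂) • pField p ζ := by
    simp only [smul_sub, sub_smul]
    abel
  have hM : 0 ≤ M := (norm_nonneg _).trans hξ
  have h0 : 0 ≤ (p - 1) * M ^ (p - 2) * ‖ξ - ζ‖ ^ 2 := by
    have : 0 ≤ p - 1 := by linarith
    positivity
  have h2 : -(L * M ^ (p - 1) * D * ‖ξ - ζ‖) ≤ inner ℝ ((a₁ - a₂) • pField p ζ) (ξ - ζ) := by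
    refine neg_le_of_abs_le ((abs_real_inner_le_norm _ _).trans ?_)
    rw [norm_smul, norm_pField hp₁, Real.norm_eq_abs]
    have : ‖ζ‖ ^ (p - 1) ≤ M ^ (p - 1) := Real.rpow_le_rpow (norm_nonneg _) hζ (by linarith)
    calc |a₁ - a₂| * ‖ζ‖ ^ (p - 1) * ‖ξ - ζ‖ ≤ (L * D) * M ^ (p - 1) * ‖ξ - ζ‖ := by
          have := (abs_nonneg _).trans hd
          gcongr
      _ = _ := by ring
  rw [hdec, inner_add_left, inner_smul_left, RCLike.conj_to_real]
  have h3 : γ * ((p - 1) * M ^ (p - 2) * ‖ξ - ζ‖ ^ 2) ≤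
      a₁ * inner ℝ (pField p ξ - pField p ζ) (ξ - ζ) :=
    mul_le_mul ha h1 h0 (hγ.trans ha)
  linarith

lemma norm_flux_sub_le {p M K L D a₁ a₂ : ℝ} (hp₁ : 1 < p) (hp₂ : p < 2) {ξ ζ : E}
    (hζ : ‖ζ‖ ≤ M) (ha : |a₁| ≤ K) (hd : |a₁ - a₂| ≤ L * D) :
    ‖a₁ • pField p ξ - a₂ • pField p ζ‖ ≤
      2 * K * ‖ξ - ζ‖ ^ (p - 1) + L * M ^ (p - 1) * D := by
  have hdec : a₁ • pField p ξ - a₂ • pField p ζ =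
      a₁ • (pField p ξ - pField p ζ) + (a₁ - a₂) • pField p ζ := by
    simp only [smul_sub, sub_smul]
    abel
  rw [hdec]
  refine (norm_add_le _ _).trans ?_
  rw [norm_smul, norm_smul, norm_pField hp₁, Real.norm_eq_abs, Real.norm_eq_abs]
  have h1 : ‖ζ‖ ^ (p - 1) ≤ M ^ (p - 1) := Real.rpow_le_rpow (norm_nonneg _) hζ (by linarith)
  have h2 := norm_pField_sub_le hp₁ hp₂ ξ ζ
  have hLD := (abs_nonneg _).trans hd
  have hK := (abs_nonneg _).trans ha
  calc _ ≤ K * (2 * ‖ξ - ζ‖ ^ (p - 1)) + (L * D) * M ^ (p - 1) := by gcongr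
    _ = _ := by ring

lemma lowerOrder_sub_ge {F : Type*} [NormedAddCommGroup F] {q M K L L' D b₁ b₂ f₁ f₂ : ℝ}
    (hq : 1 < q) {ξ ζ : F}
    (hξ : ‖ξ‖ ≤ M) (hζ : ‖ζ‖ ≤ M) (hb : |b₁| ≤ K) (hd : |b₁ - b₂| ≤ L * D)
    (hf : |f₁ - f₂| ≤ L' * D) :
    -(K * (q * M ^ (q - 1)) * ‖ξ - ζ‖ + (L * M ^ q + L') * D) ≤
      (b₁ * ‖ξ‖ ^ q - f₁) - (b₂ * ‖ζ‖ ^ q - f₂) := by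
  have h1 := abs_rpow_sub_rpow_le hq (norm_nonneg ξ) (norm_nonneg ζ) hξ hζ
  have h2 : |‖ξ‖ - ‖ζ‖| ≤ ‖ξ - ζ‖ := abs_norm_sub_norm_le ξ ζ
  have h3 : ‖ζ‖ ^ q ≤ M ^ q := Real.rpow_le_rpow (norm_nonneg _) hζ (by linarith)
  have hM : 0 ≤ M := (norm_nonneg _).trans hξ
  have h4 : |b₁ * (‖ξ‖ ^ q - ‖ζ‖ ^ q)| ≤ K * (q * M ^ (q - 1) * ‖ξ - ζ‖) := by
    rw [abs_mul]
    refine mul_le_mul hb (h1.trans ?_) (abs_nonneg _) ((abs_nonneg _).trans hb)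
    exact mul_le_mul_of_nonneg_left h2 (by positivity)
  have h5 : |(b₁ - b₂) * ‖ζ‖ ^ q| ≤ L * D * M ^ q := by
    rw [abs_mul, abs_of_nonneg (show 0 ≤ ‖ζ‖ ^ q by positivity)]
    exact mul_le_mul hd h3 (by positivity) ((abs_nonneg _).trans hd)
  have e : (b₁ * ‖ξ‖ ^ q - f₁) - (b₂ * ‖ζ‖ ^ q - f₂) =
      b₁ * (‖ξ‖ ^ q - ‖ζ‖ ^ q) + (b₁ - b₂) * ‖ζ‖ ^ q - (f₁ - f₂) := by ring
  rw [e]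
  have := neg_le_of_abs_le h4
  have := neg_le_of_abs_le h5
  have := le_of_abs_le hf
  linarith

end Coefficients

/-! ### The pointwise energy inequality -/

section PointwiseEstimate

/-- Linearisation of the sublinear power at a free scale `σ`: above `σ` the factor `z ^ (p - 2)` is
at most `σ ^ (p - 2)`, below it `z ^ (p - 1) ≤ σ ^ (p - 1)`. -/
lemma rpow_sub_one_le_of_pos {p σ z : ℝ} (hp₁ : 1 < p) (hp₂ : p < 2) (hσ : 0 < σ) (hz : 0 ≤ z) :
    z ^ (p - 1) ≤ σ ^ (p - 2) * (z + σ) := by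
  have hs : 0 ≤ σ ^ (p - 2) := by positivity
  rcases le_total σ z with h | h
  · rw [rpow_sub_one_eq hp₁ hz]
    have : z ^ (p - 2) ≤ σ ^ (p - 2) := Real.rpow_le_rpow_of_nonpos hσ h (by linarith)
    nlinarith
  · have : z ^ (p - 1) ≤ σ ^ (p - 1) := Real.rpow_le_rpow hz h (by linarith)
    rw [rpow_sub_one_eq hp₁ hσ.le] at this
    nlinarith

lemma pow_succ_mul_le {w z : ℝ} (hw : 0 ≤ w) (hz : 0 ≤ z) (n : ℕ) :
    w ^ (n + 1) * z ≤ w ^ (n + 2) + z ^ (n + 2) := by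
  rcases le_total z w with h | h
  · have : w ^ (n + 1) * z ≤ w ^ (n + 1) * w := by gcongr
    rw [← pow_succ] at this
    have : 0 ≤ z ^ (n + 2) := by positivity
    linarith
  · have : w ^ (n + 1) * z ≤ z ^ (n + 1) * z := by gcongr
    rw [← pow_succ] at this
    have : 0 ≤ w ^ (n + 2) := by positivity
    linarith

/-- Absorption of the sublinear cutoff error: the power `η ^ (k (n + 2))` of the cutoff is chosen
so that the remainder does not depend on `η`. -/
lemma cutoff_error_le {p R η w z : ℝ} (hp₁ : 1 < p) (hp₂ : p < 2) {n k : ℕ}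
    (hk : 1 ≤ (k : ℝ) * (2 - p)) (hR : 0 < R) (hη : 0 < η) (hη1 : η ≤ 1) (hw : 0 ≤ w)
    (hz : 0 ≤ z) :
    R⁻¹ * η ^ (k * (n + 2) - 1) * w ^ (n + 1) * z ^ (p - 1) ≤
      R ^ (1 - p) * (η ^ (k * (n + 2)) * (w ^ (n + 1) * z) + η ^ (k * (n + 2)) * w ^ (n + 2)
        + (R ^ (n + 2))⁻¹) := by
  have hk0 : k ≠ 0 := by
    rintro rfl
    norm_num at hk
  have hm : k * (n + 2) ≠ 0 := by positivity
  set m := k * (n + 2) with hmdef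
  -- This scale does two things: `σ ^ (p - 2)` supplies the factor `η` missing from `η ^ (m - 1)`,
  -- thanks to `1 ≤ k * (2 - p)`, and `η ^ m * σ ^ (n + 2)` is exactly `R ^ (-(n + 2))`.
  set σ := R⁻¹ * (η ^ k)⁻¹ with hσdef
  have hσ : 0 < σ := by positivity
  have h1 := rpow_sub_one_le_of_pos hp₁ hp₂ hσ hz
  have h2 : σ ^ (p - 2) ≤ R ^ (2 - p) * η := by
    rw [hσdef, ← mul_inv, Real.inv_rpow (by positivity), ← Real.rpow_neg (by positivity),
      neg_sub, Real.mul_rpow hR.le (by positivity), ← Real.rpow_natCast, ← Real.rpow_mul hη.le]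
    have : η ^ ((k : ℝ) * (2 - p)) ≤ η ^ (1 : ℝ) :=
      Real.rpow_le_rpow_of_exponent_ge hη hη1 hk
    rw [Real.rpow_one] at this
    gcongr
  have h3 : R⁻¹ * R ^ (2 - p) = R ^ (1 - p) := by
    rw [← Real.rpow_neg_one, ← Real.rpow_add hR]
    ring_nf
  have h4 : η ^ (m - 1) * η = η ^ m := pow_sub_one_mul hm η
  have h5 : η ^ m * σ ^ (n + 2) = (R ^ (n + 2))⁻¹ := by
    rw [hσdef, mul_pow, hmdef, pow_mul, inv_pow, inv_pow]
    field_simp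
  have h6 := pow_succ_mul_le hw hσ.le n
  have hηm : 0 ≤ η ^ m := by positivity
  calc R⁻¹ * η ^ (m - 1) * w ^ (n + 1) * z ^ (p - 1)
      ≤ R⁻¹ * η ^ (m - 1) * w ^ (n + 1) * (R ^ (2 - p) * η * (z + σ)) := by
        have : σ ^ (p - 2) * (z + σ) ≤ R ^ (2 - p) * η * (z + σ) := by gcongr
        have := h1.trans this
        gcongr
    _ = R ^ (1 - p) * (η ^ m * (w ^ (n + 1) * z) + η ^ m * (w ^ (n + 1) * σ)) := by
        rw [← h3, ← h4]; ring
    _ ≤ R ^ (1 - p) * (η ^ m * (w ^ (n + 1) * z) + η ^ m * (w ^ (n + 2) + σ ^ (n + 2))) := by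
        gcongr
    _ = _ := by rw [mul_add (η ^ m), h5]; ring

lemma mul_cross_term_le {P b φ w g : ℝ} (hb : 0 < b) (hφ : 0 ≤ φ) (hw : 0 ≤ w) (n : ℕ) :
    P * (w ^ (n + 1) * φ * g) ≤
      b / 2 * (w ^ n * φ * g ^ 2) + P ^ 2 / (2 * b) * (w ^ (n + 2) * φ) := by
  have h1 : P * (w * g) ≤ b / 2 * g ^ 2 + P ^ 2 / (2 * b) * w ^ 2 := by
    have h2 : b / 2 * g ^ 2 + P ^ 2 / (2 * b) * w ^ 2 - P * (w * g) =
        (b * g - P * w) ^ 2 / (2 * b) := by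
      field_simp
      ring
    have h3 : 0 ≤ (b * g - P * w) ^ 2 / (2 * b) := by positivity
    linarith
  have h2 : 0 ≤ w ^ n * φ := by positivity
  have := mul_le_mul_of_nonneg_left h1 h2
  calc _ = w ^ n * φ * (P * (w * g)) := by ring
    _ ≤ _ := this
    _ = _ := by ring

lemma pow_succ_mul_le_sq {w g : ℝ} (hw : 0 ≤ w) (n : ℕ) :
    w ^ (n + 1) * g ≤ w ^ n * g ^ 2 + w ^ (n + 2) := by
  have h1 : w * g ≤ g ^ 2 + w ^ 2 := by nlinarith [sq_nonneg (w - g)]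
  have h2 := mul_le_mul_of_nonneg_left h1 (show 0 ≤ w ^ n by positivity)
  calc _ = w ^ n * (w * g) := by ring
    _ ≤ _ := h2
    _ = _ := by ring

/-- The linear term in `w` also lacks a factor `η`; bounding it by `W ^ (2 - p) * w ^ (p - 1)` lets
`cutoff_error_le` treat it like the gradient term. In `A + 1`, `A` comes from the flux and `1` from
the cutoff term of the Poincaré identity. The smallness conditions hold for large `R` because `p >
1`. -/
lemma cutoff_terms_le {p R η w g W K A b C : ℝ} {n k m : ℕ}
    (hp₁ : 1 < p) (hp₂ : p < 2) (hk : 1 ≤ (k : ℝ) * (2 - p)) (hm : m = k * (n + 2)) (hR : 0 < R)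
    (hη : 0 < η) (hη1 : η ≤ 1) (hw : 0 < w) (hwW : w ≤ W) (hg : 0 ≤ g)
    (hK : 0 ≤ K) (hA : 0 ≤ A) (hC : 0 ≤ C)
    (hR₁ : m * C * (2 * K + (A + 1) * W ^ (2 - p)) * R ^ (1 - p) ≤ b / 2)
    (hR₂ : m * C * (2 * K + (A + 1) * W ^ (2 - p)) * R ^ (1 - p) ≤ 1 / 2) :
    C * (R⁻¹ * (m * η ^ (m - 1)) * w ^ (n + 1)) * (2 * K * g ^ (p - 1) + (A + 1) * w) ≤
      b / 2 * (w ^ n * η ^ m * g ^ 2) + w ^ (n + 2) * η ^ m + (R ^ (n + 2))⁻¹ := by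
  have hW : 0 < W := hw.trans_le hwW
  have hwg := pow_succ_mul_le_sq (g := g) hw.le n
  have hwp : w ≤ W ^ (2 - p) * w ^ (p - 1) := by
    have h1 : w ^ (2 - p) ≤ W ^ (2 - p) := Real.rpow_le_rpow hw.le hwW (by linarith)
    have h2 : w ^ (2 - p) * w ^ (p - 1) = w := by
      rw [← Real.rpow_add hw, show 2 - p + (p - 1) = 1 by ring, Real.rpow_one]
    calc w = w ^ (2 - p) * w ^ (p - 1) := h2.symm
      _ ≤ _ := by gcongr
  have E1 := cutoff_error_le hp₁ hp₂ (n := n) hk hR hη hη1 hw.le hg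
  have E2 := cutoff_error_le hp₁ hp₂ (n := n) hk hR hη hη1 hw.le hw.le
  rw [← hm] at E1 E2
  rw [← pow_succ] at E2
  have hφ0 : 0 ≤ η ^ m := by positivity
  set φ := η ^ m
  set ρ := R ^ (1 - p)
  have hρ0 : 0 ≤ ρ := by positivity
  set r := (R ^ (n + 2))⁻¹
  have hr0 : 0 ≤ r := by positivity
  set V := W ^ (2 - p) with hV
  have hV0 : 0 ≤ V := by positivity
  set T := w ^ n * φ * g ^ 2 + 2 * (w ^ (n + 2) * φ) + r with hT
  have hT0 : 0 ≤ T := by positivity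
  have F1 : R⁻¹ * η ^ (m - 1) * w ^ (n + 1) * g ^ (p - 1) ≤ ρ * T := by
    refine E1.trans ?_
    have := mul_le_mul_of_nonneg_left hwg hφ0
    refine mul_le_mul_of_nonneg_left ?_ hρ0
    rw [hT]
    linarith
  have F2 : R⁻¹ * η ^ (m - 1) * w ^ (n + 1) * w ^ (p - 1) ≤ ρ * T := by
    refine E2.trans ?_
    refine mul_le_mul_of_nonneg_left ?_ hρ0
    have : 0 ≤ w ^ n * φ * g ^ 2 := by positivity
    rw [hT]
    linarith
  calc C * (R⁻¹ * (m * η ^ (m - 1)) * w ^ (n + 1)) * (2 * K * g ^ (p - 1) + (A + 1) * w)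
      ≤ C * (R⁻¹ * (m * η ^ (m - 1)) * w ^ (n + 1)) *
          (2 * K * g ^ (p - 1) + (A + 1) * (V * w ^ (p - 1))) := by
        gcongr
    _ = m * C * (2 * K * (R⁻¹ * η ^ (m - 1) * w ^ (n + 1) * g ^ (p - 1))
          + (A + 1) * V * (R⁻¹ * η ^ (m - 1) * w ^ (n + 1) * w ^ (p - 1))) := by
        ring
    _ ≤ m * C * (2 * K * (ρ * T) + (A + 1) * V * (ρ * T)) := by gcongr
    _ = (m * C * (2 * K + (A + 1) * V) * ρ) * (w ^ n * φ * g ^ 2)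
          + (m * C * (2 * K + (A + 1) * V) * ρ) * (2 * (w ^ (n + 2) * φ) + r) := by
        rw [hT]; ring
    _ ≤ b / 2 * (w ^ n * φ * g ^ 2) + 1 / 2 * (2 * (w ^ (n + 2) * φ) + r) := by
        gcongr
    _ ≤ _ := by linarith

/-- The pointwise inequality behind the comparison principle: the density of the weak formulation
tested with `w ^ (n + 1) η ^ m`, plus `Λ` times the density of the Poincaré identity for
`w ^ (n + 2) η ^ m`, dominates `w ^ (n + 2) η ^ m` up to small errors. -/
lemma energy_density_ge {p R η w g W G₀ ε K A B₁ B₂ c₀ C P Λ lam h₁ h₂ h₃ Y ℓ₁ ℓ₂ : ℝ} {n k m : ℕ}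
    (hp₁ : 1 < p) (hp₂ : p < 2) (hk : 1 ≤ (k : ℝ) * (2 - p)) (hm : m = k * (n + 2)) (hR : 1 ≤ R)
    (hη : 0 ≤ η) (hη1 : η ≤ 1) (hw : 0 < w) (hwW : w ≤ W) (hg : 0 ≤ g) (hgG : g ≤ G₀) (hε : 0 ≤ ε)
    (hK : 0 ≤ K) (hA : 0 ≤ A) (hB₂ : 0 ≤ B₂) (hc₀ : 0 < c₀) (hC : 0 ≤ C)
    (hP : P = (n + 1) * A + B₁ + (n + 2) / 2)
    (hΛ : Λ = P ^ 2 / (2 * ((n + 1) * c₀)) + B₂ + 2) (hlam : Λ * lam ≤ 1)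
    (hR₁ : m * C * (2 * K + (A + 1) * W ^ (2 - p)) * R ^ (1 - p) ≤ (n + 1) * c₀ / 2)
    (hR₂ : m * C * (2 * K + (A + 1) * W ^ (2 - p)) * R ^ (1 - p) ≤ 1 / 2)
    (hh₁ : c₀ * g ^ 2 - A * (w + ε) * g ≤ h₁)
    (hh₂ : |h₂| ≤ C / R * (2 * K * g ^ (p - 1) + A * (w + ε)))
    (hh₃ : -(B₁ * g + B₂ * (w + ε)) ≤ h₃)
    (hY : |Y| ≤ lam / 2) (hℓ₁ : |ℓ₁| ≤ g) (hℓ₂ : |ℓ₂| ≤ C / R) :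
    w ^ (n + 2) * η ^ m ≤
      ((n + 1) * w ^ n * η ^ m * h₁ + w ^ (n + 1) * (m * η ^ (m - 1)) * h₂
          + h₃ * (w ^ (n + 1) * η ^ m))
        + Λ * (Y * ((n + 2) * w ^ (n + 1) * η ^ m * ℓ₁ + w ^ (n + 2) * (m * η ^ (m - 1)) * ℓ₂)
            + w ^ (n + 2) * η ^ m)
        + ((R ^ (n + 2))⁻¹
            + ε * ((n + 1) * W ^ n * A * G₀ + W ^ (n + 1) * m * C * A + W ^ (n + 1) * B₂)) := by
  have hR0 : 0 < R := by linarith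
  have hW : 0 < W := hw.trans_le hwW
  have hG₀ : 0 ≤ G₀ := hg.trans hgG
  have hΛ0 : 0 ≤ Λ := by rw [hΛ]; positivity
  have hk0 : k ≠ 0 := by
    rintro rfl
    norm_num at hk
  have hm0 : m ≠ 0 := by rw [hm]; positivity
  -- The scale `σ` needs `η > 0`. At `η = 0` the factor `η ^ (m - 1)` vanishes as well, because `m ≥
  -- 2`.
  rcases hη.eq_or_lt with rfl | hηp
  · rw [zero_pow hm0]
    rcases Nat.lt_or_ge 1 m with h1 | h1
    · rw [zero_pow (show m - 1 ≠ 0 by omega)]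
      simp only [mul_zero, zero_mul, add_zero, zero_add]
      positivity
    · have : 2 ≤ m := by
        rw [hm]
        exact Nat.mul_le_mul (Nat.pos_of_ne_zero hk0) (Nat.le_add_left 2 n)
      omega
  set φ := η ^ m with hφ
  set χ := (m : ℝ) * η ^ (m - 1) with hχ
  have hφ0 : 0 ≤ φ := by positivity
  have hφ1 : φ ≤ 1 := pow_le_one₀ hη hη1
  have hχ0 : 0 ≤ χ := by positivity
  have hχm : χ ≤ m := by
    have : η ^ (m - 1) ≤ 1 := pow_le_one₀ hη hη1
    rw [hχ]
    exact mul_le_of_le_one_right (by positivity) this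
  have hR1 : R⁻¹ ≤ 1 := inv_le_one_of_one_le₀ hR
  have hwn : w ^ n ≤ W ^ n := by gcongr
  have hwn1 : w ^ (n + 1) ≤ W ^ (n + 1) := by gcongr
  -- In `e1`, `e2`, `e3` the difference `w + ε` is replaced by `w`, at the cost of a multiple of
  -- `ε`.
  have e1 : (n + 1) * w ^ n * φ * (c₀ * g ^ 2 - A * w * g)
      - ε * ((n + 1) * W ^ n * A * G₀) ≤ (n + 1) * w ^ n * φ * h₁ := by
    have h1 : (n + 1) * w ^ n * φ * (c₀ * g ^ 2 - A * (w + ε) * g) ≤ (n + 1) * w ^ n * φ * h₁ := by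
      gcongr
    have h2 : (n + 1) * w ^ n * φ * (A * ε * g) ≤ (n + 1) * W ^ n * 1 * (A * ε * G₀) := by gcongr
    linarith
  have e2 : -(C * (R⁻¹ * χ * w ^ (n + 1)) * (2 * K * g ^ (p - 1) + A * w))
      - ε * (W ^ (n + 1) * m * C * A) ≤ w ^ (n + 1) * χ * h₂ := by
    have h1 : w ^ (n + 1) * χ * -(C / R * (2 * K * g ^ (p - 1) + A * (w + ε)))
        ≤ w ^ (n + 1) * χ * h₂ := by
      have := neg_le_of_abs_le hh₂
      gcongr
    have h2 : w ^ (n + 1) * χ * (C * R⁻¹ * (A * ε)) ≤ W ^ (n + 1) * m * (C * 1 * (A * ε)) := by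
      gcongr
    rw [div_eq_mul_inv] at h1
    linarith
  have e3 : -(w ^ (n + 1) * φ * (B₁ * g + B₂ * w)) - ε * (W ^ (n + 1) * B₂)
      ≤ h₃ * (w ^ (n + 1) * φ) := by
    have h1 : -(B₁ * g + B₂ * (w + ε)) * (w ^ (n + 1) * φ) ≤ h₃ * (w ^ (n + 1) * φ) := by gcongr
    have h2 : w ^ (n + 1) * φ * (B₂ * ε) ≤ W ^ (n + 1) * 1 * (B₂ * ε) := by gcongr
    linarith
  -- `Λ * |Y| ≤ 1 / 2`: the gradient terms from the Poincaré identity do not grow with `Λ`.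
  have e4 : -(1 / 2 * ((n + 2) * w ^ (n + 1) * φ * g + w ^ (n + 2) * χ * (C * R⁻¹)))
      ≤ Λ * (Y * ((n + 2) * w ^ (n + 1) * φ * ℓ₁ + w ^ (n + 2) * χ * ℓ₂)) := by
    have h1 : |(n + 2) * w ^ (n + 1) * φ * ℓ₁ + w ^ (n + 2) * χ * ℓ₂| ≤
        (n + 2) * w ^ (n + 1) * φ * g + w ^ (n + 2) * χ * (C * R⁻¹) := by
      refine (abs_add_le _ _).trans ?_
      rw [abs_mul, abs_mul (w ^ (n + 2) * χ), abs_of_nonneg (by positivity),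
        abs_of_nonneg (show 0 ≤ w ^ (n + 2) * χ by positivity), ← div_eq_mul_inv]
      gcongr
    refine neg_le_of_abs_le ?_
    rw [← mul_assoc, abs_mul, abs_mul, abs_of_nonneg hΛ0]
    refine mul_le_mul ?_ h1 (abs_nonneg _) (by norm_num)
    have := mul_le_mul_of_nonneg_left hY hΛ0
    linarith
  have e5 := mul_cross_term_le (P := P) (g := g) (show 0 < (n + 1) * c₀ by positivity) hφ0 hw.le n
  have e6 := cutoff_terms_le hp₁ hp₂ hk hm hR0 hηp hη1 hw hwW hg hK hA hC hR₁ hR₂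
  rw [← hχ, ← hφ] at e6
  have e7 : C * (R⁻¹ * χ * w ^ (n + 1)) * (2 * K * g ^ (p - 1) + A * w)
      + 1 / 2 * (w ^ (n + 2) * χ * (C * R⁻¹)) ≤
      C * (R⁻¹ * χ * w ^ (n + 1)) * (2 * K * g ^ (p - 1) + (A + 1) * w) := by
    have : 0 ≤ C * (R⁻¹ * χ * w ^ (n + 1)) * w := by positivity
    have h' : w ^ (n + 2) * χ * (C * R⁻¹) = C * (R⁻¹ * χ * w ^ (n + 1)) * w := by ring
    rw [h']
    linarith
  -- `P` collects all terms linear in `g`. Half of the coercive term absorbs them, the other half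
  -- absorbs the cutoff error.
  have e8 : P * (w ^ (n + 1) * φ * g) = (n + 1) * w ^ n * φ * (A * w * g)
      + w ^ (n + 1) * φ * (B₁ * g) + 1 / 2 * ((n + 2) * w ^ (n + 1) * φ * g) := by
    rw [hP]; ring
  -- The budget of `Λ`: completing the square, the zero order coefficient `B₂`, one unit for the
  -- cutoff error, and one unit left over as the claimed lower bound.
  have e9 : Λ * (w ^ (n + 2) * φ) = P ^ 2 / (2 * ((n + 1) * c₀)) * (w ^ (n + 2) * φ)
      + w ^ (n + 1) * φ * (B₂ * w) + 2 * (w ^ (n + 2) * φ) := by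
    rw [hΛ]; ring
  linarith

end PointwiseEstimate

/-! ### The difference of the two weak inequalities -/

section WeakDifference

variable {n : ℕ}

/-- Regularity and bounds used for sub- and supersolutions: `u` is continuous on the closure of `Ω`,
it is `C¹` in `Ω` with values in `I`, and its gradient is bounded by `M`. -/
structure BddC1 (Ω : Set (Pt n)) (I : Set ℝ) (M : ℝ) (u : Pt n → ℝ) : Prop where
  cont : ContinuousOn u (closure Ω)
  diff : ∀ x ∈ Ω, DifferentiableAt ℝ u x
  grad_cont : ContinuousOn (gradient u) Ω
  mem : ∀ x ∈ Ω, u x ∈ I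
  grad_le : ∀ x ∈ Ω, ‖gradient u x‖ ≤ M

/-- The flux `a(x, u) |∇u|^{p-2} ∇u`. -/
noncomputable def flux (p : ℝ) (a : Pt n → ℝ → ℝ) (u : Pt n → ℝ) (x : Pt n) : Pt n :=
  a x (u x) • pField p (gradient u x)

/-- The lower order terms `b(x, u) |∇u|^q - f(x, u)`. -/
noncomputable def lowerOrder (q : ℝ) (b f : Pt n → ℝ → ℝ) (u : Pt n → ℝ) (x : Pt n) : ℝ :=
  b x (u x) * ‖gradient u x‖ ^ q - f x (u x)

lemma ContCoeff.comp {c : Pt n → ℝ → ℝ} (hc : ContCoeff c) {Ω : Set (Pt n)}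
    (hΩ : Ω ⊆ halfSpace n) {u : Pt n → ℝ} (hu : ContinuousOn u Ω) :
    ContinuousOn (fun x => c x (u x)) Ω :=
  ContinuousOn.comp (t := halfSpace n ×ˢ Set.univ) (g := fun z : Pt n × ℝ => c z.1 z.2) hc
    (continuousOn_id.prodMk hu) fun _ hx => ⟨hΩ hx, Set.mem_univ _⟩

variable {p q M : ℝ} {a b f : Pt n → ℝ → ℝ} {Ω : Set (Pt n)} {I : Set ℝ} {u v : Pt n → ℝ}

lemma BddC1.continuousOn_flux (hu : BddC1 Ω I M u) (hp₁ : 1 < p) (hp₂ : p < 2)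
    (hΩ : Ω ⊆ halfSpace n) (ha : ContCoeff a) : ContinuousOn (flux p a u) Ω :=
  (ha.comp hΩ (hu.cont.mono subset_closure)).smul
    ((continuous_pField hp₁ hp₂).comp_continuousOn hu.grad_cont)

lemma BddC1.continuousOn_norm_rpow (hu : BddC1 Ω I M u) (hq : 1 < q) :
    ContinuousOn (fun x => ‖gradient u x‖ ^ q) Ω :=
  hu.grad_cont.norm.rpow_const fun _ _ => Or.inr (by linarith)

lemma BddC1.continuousOn_lowerOrder (hu : BddC1 Ω I M u) (hq : 1 < q)
    (hΩ : Ω ⊆ halfSpace n) (hb : ContCoeff b) (hf : ContCoeff f) :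
    ContinuousOn (lowerOrder q b f u) Ω :=
  ((hb.comp hΩ (hu.cont.mono subset_closure)).mul (hu.continuousOn_norm_rpow hq)).sub
    (hf.comp hΩ (hu.cont.mono subset_closure))

lemma BddC1.weakForm_sub_eq (hu : BddC1 Ω I M u) (hp₁ : 1 < p) (hp₂ : p < 2) (hq : 1 < q)
    (hΩ : Ω ⊆ halfSpace n) (ha : ContCoeff a) (hb : ContCoeff b) (hf : ContCoeff f)
    {φ : Pt n → ℝ} (hφ : IsTest Ω φ) :
    weakForm p q a b Ω u φ - ∫ x in Ω, f x (u x) * φ x =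
      ∫ x, (inner ℝ (flux p a u x) (gradient φ x) + lowerOrder q b f u x * φ x) := by
  have hφ1 : ContDiff ℝ 1 φ := hφ.smooth.of_le (by exact_mod_cast le_top)
  have huc := hu.cont.mono subset_closure
  have i1 := integrable_test (hu.continuousOn_flux hp₁ hp₂ hΩ ha)
    ((hb.comp hΩ huc).mul (hu.continuousOn_norm_rpow hq)) hφ1 hφ.compact hφ.supp
  have i2 := integrable_test (H := fun _ => 0) continuousOn_const (hf.comp hΩ huc) hφ1
    hφ.compact hφ.supp
  simp only [inner_zero_left, zero_add] at i2
  simp only [Pi.mul_apply] at i1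
  have e1 : weakForm p q a b Ω u φ = ∫ x in Ω, (inner ℝ (flux p a u x) (gradient φ x)
      + b x (u x) * ‖gradient u x‖ ^ q * φ x) := by
    refine integral_congr_ae (Filter.Eventually.of_forall fun x => ?_)
    simp only [flux, pField, inner_smul_left, RCLike.conj_to_real]
    ring
  rw [e1]
  rw [← integral_sub i1.integrableOn i2.integrableOn]
  rw [← setIntegral_eq_integral_of_forall_compl_eq_zero (μ := (volume : Measure (Pt n))) (s := Ω)
    (f := fun x => inner ℝ (flux p a u x) (gradient φ x) + lowerOrder q b f u x * φ x)]
  · refine integral_congr_ae (Filter.Eventually.of_forall fun x => ?_)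
    simp only [lowerOrder]
    ring
  · intro x hx
    have hx' : x ∉ tsupport φ := fun h => hx (hφ.supp h)
    rw [gradient_eq_zero_of_notMem_tsupport hx', image_eq_zero_of_notMem_tsupport hx']
    simp

/-- The difference of the weak inequalities of a subsolution and a supersolution, for `C¹` test
functions. -/
lemma integral_flux_sub_nonpos (hu : BddC1 Ω I M u) (hv : BddC1 Ω I M v) (hp₁ : 1 < p)
    (hp₂ : p < 2) (hq : 1 < q) (hΩo : IsOpen Ω) (hΩ : Ω ⊆ halfSpace n) (ha : ContCoeff a)
    (hb : ContCoeff b) (hf : ContCoeff f) (hsub : IsWeakSub p q a b f Ω u)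
    (hsup : IsWeakSuper p q a b f Ω v) {ψ : Pt n → ℝ} (hψ : ContDiff ℝ 1 ψ)
    (hc : HasCompactSupport ψ) (hs : tsupport ψ ⊆ Ω) (h0 : ∀ x, 0 ≤ ψ x) :
    ∫ x, (inner ℝ (flux p a u x - flux p a v x) (gradient ψ x)
      + (lowerOrder q b f u x - lowerOrder q b f v x) * ψ x) ≤ 0 := by
  have cu := hu.continuousOn_flux hp₁ hp₂ hΩ ha
  have cv := hv.continuousOn_flux hp₁ hp₂ hΩ ha
  have lu := hu.continuousOn_lowerOrder hq hΩ hb hf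
  have lv := hv.continuousOn_lowerOrder hq hΩ hb hf
  refine integral_test_nonpos_of_C1 hΩo (cu.sub cv) (lu.sub lv) (fun φ hφ => ?_) hψ hc hs h0
  have hφ1 : ContDiff ℝ 1 φ := hφ.smooth.of_le (by exact_mod_cast le_top)
  have h1 := hu.weakForm_sub_eq hp₁ hp₂ hq hΩ ha hb hf hφ
  have h2 := hv.weakForm_sub_eq hp₁ hp₂ hq hΩ ha hb hf hφ
  have h3 := hsub φ hφ
  have h4 := hsup φ hφ
  have e : ∫ x, (inner ℝ (flux p a u x - flux p a v x) (gradient φ x)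
      + (lowerOrder q b f u x - lowerOrder q b f v x) * φ x) =
      (∫ x, (inner ℝ (flux p a u x) (gradient φ x) + lowerOrder q b f u x * φ x)) -
      ∫ x, (inner ℝ (flux p a v x) (gradient φ x) + lowerOrder q b f v x * φ x) := by
    rw [← integral_sub (integrable_test cu lu hφ1 hφ.compact hφ.supp)
      (integrable_test cv lv hφ1 hφ.compact hφ.supp)]
    refine integral_congr_ae (Filter.Eventually.of_forall fun x => ?_)
    simp only [inner_sub_left]
    ring
  refine e.trans_le ?_
  linarith

end WeakDifference

/-! ### Geometry of the strip -/

section Strip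

variable {n : ℕ} {lam y₀ : ℝ}

lemma isOpen_strip : IsOpen (strip n lam y₀) :=
  isOpen_Ioo.preimage (EuclideanSpace.proj (𝕜 := ℝ) (Fin.last n)).continuous

lemma strip_subset_halfSpace (h : lam / 2 ≤ y₀) : strip n lam y₀ ⊆ halfSpace n := by
  intro x hx
  have h1 : y₀ - lam / 2 < x (Fin.last n) := hx.1
  change 0 < x (Fin.last n)
  linarith

lemma abs_last_sub_le {x : Pt n} (hx : x ∈ strip n lam y₀) : |x (Fin.last n) - y₀| ≤ lam / 2 := by
  have h1 : y₀ - lam / 2 < x (Fin.last n) := hx.1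
  have h2 : x (Fin.last n) < y₀ + lam / 2 := hx.2
  rw [abs_le]
  constructor <;> linarith

end Strip

/-! ### Test functions built from truncation and cutoff -/

section Energy

lemma tsupport_trunc_pow_mul_subset {E : Type*} [TopologicalSpace E] {S : Set E} {d η : E → ℝ} {ε : ℝ}
    {n m : ℕ} (hm : m ≠ 0) :
    tsupport (fun y => trunc S d ε y ^ (n + 1) * η y ^ m) ⊆
      closure (truncSet S d ε) ∩ tsupport η := by
  refine closure_minimal (fun x hx => ?_) (isClosed_closure.inter (isClosed_tsupport η))
  refine ⟨subset_closure ?_, subset_tsupport η ?_⟩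
  · by_contra h
    exact hx (by simp [trunc_of_notMem h])
  · intro h
    exact hx (by simp [h, hm])

variable {E : Type*} [NormedAddCommGroup E] [NormedSpace ℝ E] {S : Set E} {d η : E → ℝ} {ε : ℝ}

/-- Here `N ≥ 2` enters: `1 ≤ n` makes the exponent `n + 1` at least two, so the power of the
truncation is differentiable. -/
lemma hasFDerivAt_trunc_pow_mul (hS : IsOpen S) (hdc : ContinuousOn d (closure S))
    (hfr : ∀ x ∈ frontier S, d x ≤ 0) (hε : 0 < ε) (hd : ∀ x ∈ S, DifferentiableAt ℝ d x)
    (hη : Differentiable ℝ η) {n : ℕ} (hn : 1 ≤ n) (m : ℕ) (x : E) :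
    HasFDerivAt (fun y => trunc S d ε y ^ (n + 1) * η y ^ m)
      (((n + 1) * trunc S d ε x ^ n * η x ^ m) • fderiv ℝ d x
        + (trunc S d ε x ^ (n + 1) * (m * η x ^ (m - 1))) • fderiv ℝ η x) x := by
  obtain ⟨k, rfl⟩ := Nat.exists_eq_add_of_le' hn
  have h1 := hasFDerivAt_trunc_pow hS hdc hfr hε hd k x
  have h2 := (hη x).hasFDerivAt.pow m
  refine (h1.mul h2).congr_fderiv ?_
  ext z
  simp
  ring

lemma contDiff_trunc_pow_mul (hS : IsOpen S) (hdc : ContinuousOn d (closure S))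
    (hfr : ∀ x ∈ frontier S, d x ≤ 0) (hε : 0 < ε) (hd : ∀ x ∈ S, DifferentiableAt ℝ d x)
    (hdf : ContinuousOn (fderiv ℝ d) S) (hη : ContDiff ℝ 1 η) {n : ℕ} (hn : 1 ≤ n) (m : ℕ) :
    ContDiff ℝ 1 (fun y => trunc S d ε y ^ (n + 1) * η y ^ m) := by
  obtain ⟨k, rfl⟩ := Nat.exists_eq_add_of_le' hn
  exact (contDiff_trunc_pow hS hdc hfr hε hd hdf k).mul (hη.pow m)

end Energy

/-! ### The integrated energy estimate -/

section Comparison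

open Metric

/-- The weight of the Poincaré identity in the energy estimate. -/
noncomputable def poincareWeight (n : ℕ) (A B₁ B₂ c₀ : ℝ) : ℝ :=
  ((n + 1) * A + B₁ + (n + 2) / 2) ^ 2 / (2 * ((n + 1) * c₀)) + B₂ + 2

variable {n : ℕ} {p q M γ La Lb Lf K lam y₀ : ℝ} {a b f : Pt n → ℝ → ℝ} {I : Set ℝ}
  {u v : Pt n → ℝ} {S : Set (Pt n)}

lemma BddC1.fderiv_sub_apply {Ω : Set (Pt n)} (hu : BddC1 Ω I M u) (hv : BddC1 Ω I M v)
    {x : Pt n} (hx : x ∈ Ω) (z : Pt n) :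
    fderiv ℝ (fun x => u x - v x) x z = inner ℝ z (gradient u x - gradient v x) := by
  rw [fderiv_fun_sub (hu.diff x hx) (hv.diff x hx), inner_sub_right, sub_apply,
    real_inner_comm, real_inner_comm (gradient v x), gradient, gradient,
    InnerProductSpace.toDual_symm_apply, InnerProductSpace.toDual_symm_apply]

lemma BddC1.continuousOn_fderiv_sub {Ω : Set (Pt n)} (hu : BddC1 Ω I M u) (hv : BddC1 Ω I M v) :
    ContinuousOn (fderiv ℝ (fun x => u x - v x)) Ω := by
  have h : ContinuousOn (fun x => InnerProductSpace.toDual ℝ (Pt n)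
      (gradient u x - gradient v x)) Ω :=
    (InnerProductSpace.toDual ℝ (Pt n)).continuous.comp_continuousOn
      (hu.grad_cont.sub hv.grad_cont)
  refine h.congr fun x hx => ?_
  ext z
  rw [hu.fderiv_sub_apply hv hx, InnerProductSpace.toDual_apply_apply, real_inner_comm]

/-- Integrated energy estimate for the truncated difference of a sub- and a supersolution. -/
lemma integral_trunc_pow_le (hn : 1 ≤ n) (hp₁ : 1 < p) (hp₂ : p < 2) (hq : 1 < q)
    (hM : 0 < M) (hγ : 0 < γ) (hLa : 0 ≤ La) (hLb : 0 ≤ Lb) (hLf : 0 ≤ Lf)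
    (ha : ContCoeff a) (hb : ContCoeff b) (hf : ContCoeff f) (hst : StructOn a b f I La Lb Lf K)
    (hell : Elliptic a γ) (hy₀ : lam / 2 ≤ y₀) (hu : BddC1 (strip n lam y₀) I M u)
    (hv : BddC1 (strip n lam y₀) I M v) (hsub : IsWeakSub p q a b f (strip n lam y₀) u)
    (hsup : IsWeakSuper p q a b f (strip n lam y₀) v) (hS : IsOpen S)
    (hSΩ : S ⊆ strip n lam y₀) (hfr : ∀ x ∈ frontier S, u x ≤ v x) {W : ℝ}
    (hW : ∀ x ∈ S, u x - v x ≤ W) (hK : 0 ≤ K)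
    (hlam : poincareWeight n (La * M ^ (p - 1)) (K * (q * M ^ (q - 1))) (Lb * M ^ q + Lf)
      (γ * ((p - 1) * M ^ (p - 2))) * lam ≤ 1)
    {k m : ℕ} (hk : 1 ≤ (k : ℝ) * (2 - p)) (hm : m = k * (n + 2)) {C R : ℝ} (hC : 0 ≤ C)
    (hR : 1 ≤ R) {η : Pt n → ℝ} (hη : ContDiff ℝ 1 η) (hη0 : ∀ x, 0 ≤ η x) (hη1 : ∀ x, η x ≤ 1)
    (hηs : tsupport η ⊆ closedBall 0 (2 * R)) (hηd : ∀ x, ‖fderiv ℝ η x‖ ≤ C / R)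
    (hR₁ : m * C * (2 * K + (La * M ^ (p - 1) + 1) * W ^ (2 - p)) * R ^ (1 - p) ≤
      (n + 1) * (γ * ((p - 1) * M ^ (p - 2))) / 2)
    (hR₂ : m * C * (2 * K + (La * M ^ (p - 1) + 1) * W ^ (2 - p)) * R ^ (1 - p) ≤ 1 / 2)
    {ε : ℝ} (hε : 0 < ε) :
    Integrable (fun x => trunc S (fun x => u x - v x) ε x ^ (n + 2) * η x ^ m) ∧
    ∫ x, trunc S (fun x => u x - v x) ε x ^ (n + 2) * η x ^ m ≤
      ((R ^ (n + 2))⁻¹ + ε * ((n + 1) * |W| ^ n * (La * M ^ (p - 1)) * (2 * M)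
        + |W| ^ (n + 1) * m * C * (La * M ^ (p - 1)) + |W| ^ (n + 1) * (Lb * M ^ q + Lf)))
        * volume.real (closedBall (0 : Pt n) (2 * R)) := by
  set Ω := strip n lam y₀ with hΩ
  have hΩo : IsOpen Ω := isOpen_strip
  have hΩh : Ω ⊆ halfSpace n := strip_subset_halfSpace hy₀
  set d : Pt n → ℝ := fun x => u x - v x with hddef
  have hdc : ContinuousOn d (closure S) :=
    (hu.cont.mono (closure_mono hSΩ)).sub (hv.cont.mono (closure_mono hSΩ))
  have hfr' : ∀ x ∈ frontier S, d x ≤ 0 := fun x hx => sub_nonpos.mpr (hfr x hx)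
  have hd : ∀ x ∈ S, DifferentiableAt ℝ d x := fun x hx =>
    (hu.diff x (hSΩ hx)).sub (hv.diff x (hSΩ hx))
  have hdf : ContinuousOn (fderiv ℝ d) S := (hu.continuousOn_fderiv_sub hv).mono hSΩ
  have hηdiff : Differentiable ℝ η := hη.differentiable one_ne_zero
  have hηc : HasCompactSupport η :=
    (isCompact_closedBall 0 (2 * R)).of_isClosed_subset (isClosed_tsupport η) hηs
  have hk0 : k ≠ 0 := by
    rintro rfl
    norm_num at hk
  have hm0 : m ≠ 0 := by rw [hm]; positivity
  set w := trunc S d ε with hw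
  set A := La * M ^ (p - 1) with hA
  set B₁ := K * (q * M ^ (q - 1)) with hB₁
  set B₂ := Lb * M ^ q + Lf with hB₂
  set c₀ := γ * ((p - 1) * M ^ (p - 2)) with hc₀
  have hA0 : 0 ≤ A := by positivity
  have hB₂0 : 0 ≤ B₂ := by positivity
  have hc₀0 : 0 < c₀ := by
    have : 0 < p - 1 := by linarith
    positivity
  set ψ : Pt n → ℝ := fun x => w x ^ (n + 1) * η x ^ m with hψ
  set Ψ : Pt n → ℝ := fun x => w x ^ (n + 1 + 1) * η x ^ m with hΨ
  have hsub1 : ∀ j : ℕ, tsupport (fun x => w x ^ (j + 1) * η x ^ m) ⊆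
      closure (truncSet S d ε) ∩ tsupport η := fun j => tsupport_trunc_pow_mul_subset hm0
  have hcs : ∀ j : ℕ, HasCompactSupport (fun x => w x ^ (j + 1) * η x ^ m) := fun j =>
    hηc.isCompact.of_isClosed_subset (isClosed_tsupport _)
      ((hsub1 j).trans Set.inter_subset_right)
  have hψ1 : ContDiff ℝ 1 ψ := contDiff_trunc_pow_mul hS hdc hfr' hε hd hdf hη hn m
  have hΨ1 : ContDiff ℝ 1 Ψ :=
    contDiff_trunc_pow_mul hS hdc hfr' hε hd hdf hη (Nat.le_add_left 1 n) m
  have hψd := hasFDerivAt_trunc_pow_mul hS hdc hfr' hε hd hηdiff hn m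
  have hΨd := hasFDerivAt_trunc_pow_mul hS hdc hfr' hε hd hηdiff (Nat.le_add_left 1 n) m
  rw [← hw] at hψd hΨd
  have hψs : tsupport ψ ⊆ Ω := ((hsub1 n).trans Set.inter_subset_left).trans
    ((closure_truncSet_subset hdc hfr' hε).trans hSΩ)
  have hψ0 : ∀ x, 0 ≤ ψ x := fun x =>
    mul_nonneg (pow_nonneg (trunc_nonneg x) _) (pow_nonneg (hη0 x) _)
  set X : Pt n → ℝ := fun x => inner ℝ (flux p a u x - flux p a v x) (gradient ψ x)
    + (lowerOrder q b f u x - lowerOrder q b f v x) * ψ x with hX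
  have hXint : ∫ x, X x ≤ 0 := integral_flux_sub_nonpos hu hv hp₁ hp₂ hq hΩo hΩh ha hb hf hsub
    hsup hψ1 (hcs n) hψs hψ0
  have iX : Integrable X := integrable_test
    ((hu.continuousOn_flux hp₁ hp₂ hΩh ha).sub (hv.continuousOn_flux hp₁ hp₂ hΩh ha))
    ((hu.continuousOn_lowerOrder hq hΩh hb hf).sub (hv.continuousOn_lowerOrder hq hΩh hb hf))
    hψ1 (hcs n) hψs
  set e : Pt n := EuclideanSpace.single (Fin.last n) 1 with he
  have hen : ‖e‖ = 1 := by simp [he]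
  set Q : Pt n → ℝ := fun x => (x (Fin.last n) - y₀) * fderiv ℝ Ψ x e + Ψ x with hQ
  have hQint : ∫ x, Q x = 0 := integral_coord_mul_fderiv_add hΨ1 (hcs (n + 1)) (Fin.last n) y₀
  have iΨ : Integrable Ψ := hΨ1.continuous.integrable_of_hasCompactSupport (hcs (n + 1))
  have iQ : Integrable Q := by
    refine Integrable.add ?_ iΨ
    have hcoord : Continuous fun x : Pt n => x (Fin.last n) - y₀ :=
      (EuclideanSpace.proj (𝕜 := ℝ) (Fin.last n)).continuous.sub continuous_const
    exact (hcoord.mul ((hΨ1.continuous_fderiv one_ne_zero).clm_apply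
      continuous_const)).integrable_of_hasCompactSupport
        (((hcs (n + 1)).fderiv_apply ℝ e).mul_left)
  set Λ := poincareWeight n A B₁ B₂ c₀ with hΛ
  set κ := (R ^ (n + 2))⁻¹ + ε * ((n + 1) * |W| ^ n * A * (2 * M)
    + |W| ^ (n + 1) * m * C * A + |W| ^ (n + 1) * B₂) with hκ
  have hκ0 : 0 ≤ κ := by positivity
  set B := closedBall (0 : Pt n) (2 * R) with hB
  have iκ : Integrable (B.indicator fun _ => κ) (volume : Measure (Pt n)) :=
    (integrable_indicator_iff isClosed_closedBall.measurableSet).mpr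
      (integrableOn_const (isCompact_closedBall _ _).measure_lt_top.ne)
  have hpt : ∀ x, Ψ x ≤ X x + Λ * Q x + B.indicator (fun _ => κ) x := by
    intro x
    have hXx : X x = (n + 1) * w x ^ n * η x ^ m *
          fderiv ℝ d x (flux p a u x - flux p a v x)
        + w x ^ (n + 1) * (m * η x ^ (m - 1)) * fderiv ℝ η x (flux p a u x - flux p a v x)
        + (lowerOrder q b f u x - lowerOrder q b f v x) * (w x ^ (n + 1) * η x ^ m) := by
      rw [hX]
      simp only
      rw [real_inner_comm, gradient, InnerProductSpace.toDual_symm_apply, (hψd x).fderiv]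
      rfl
    have hQx : Q x = (x (Fin.last n) - y₀) * ((n + 2) * w x ^ (n + 1) * η x ^ m * fderiv ℝ d x e
        + w x ^ (n + 2) * (m * η x ^ (m - 1)) * fderiv ℝ η x e) + w x ^ (n + 2) * η x ^ m := by
      have hcast : (((n + 1 : ℕ) : ℝ) + 1) = n + 2 := by push_cast; ring
      rw [hQ]
      simp only
      rw [(hΨd x).fderiv, hcast]
      rfl
    have hi0 : 0 ≤ B.indicator (fun _ => κ) x := Set.indicator_nonneg (fun _ _ => hκ0) x
    by_cases hxD : x ∈ truncSet S d ε
    swap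
    -- Off the truncation set `fderiv ℝ d x` may be meaningless, but its factor `w x ^ n` vanishes
    -- since `n ≠ 0`.
    · have hw0 : w x = 0 := trunc_of_notMem hxD
      have hΨ0 : Ψ x = 0 := by simp [hΨ, hw0]
      rw [hXx, hQx, hΨ0, hw0, zero_pow (show n ≠ 0 by omega)]
      simpa using hi0
    by_cases hxB : x ∈ B
    swap
    · have hη00 : η x = 0 := image_eq_zero_of_notMem_tsupport fun h => hxB (hηs h)
      have hdη : fderiv ℝ η x = 0 :=
        image_eq_zero_of_notMem_tsupport fun h => hxB (hηs (tsupport_fderiv_subset ℝ h))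
      have hΨ0 : Ψ x = 0 := by simp [hΨ, hη00, hm0]
      rw [hXx, hQx, hΨ0, hη00, hdη, zero_pow hm0]
      simpa using hi0
    have hxΩ : x ∈ Ω := hSΩ hxD.1
    have hxh := hΩh hxΩ
    have hwx : w x = d x - ε := trunc_of_mem hxD
    have hwpos : 0 < w x := by rw [hwx]; linarith [hxD.2]
    have hdx : |u x - v x| = w x + ε := by
      rw [hwx, abs_of_pos (show 0 < u x - v x from hε.trans hxD.2)]
      simp [hddef]
    have hgu := hu.grad_le x hxΩ
    have hgv := hv.grad_le x hxΩ
    have hda := hst.lip_a x hxh _ (hu.mem x hxΩ) _ (hv.mem x hxΩ)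
    have hdb := hst.lip_b x hxh _ (hu.mem x hxΩ) _ (hv.mem x hxΩ)
    have hdf' := hst.lip_f x hxh _ (hu.mem x hxΩ) _ (hv.mem x hxΩ)
    rw [hdx] at hda hdb hdf'
    have F1 := inner_flux_sub_ge hp₁ hp₂ hgu hgv hγ.le (hell x hxh (u x)) hda
    have F2 := norm_flux_sub_le hp₁ hp₂ (ξ := gradient u x) hgv
      (hst.bdd_a x hxh _ (hu.mem x hxΩ)) hda
    have F3 := lowerOrder_sub_ge hq hgu hgv (hst.bdd_b x hxh _ (hu.mem x hxΩ)) hdb hdf'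
    have hWd : d x ≤ W := hW x hxD.1
    -- The sign of `W` is known only once a point with `d > ε` exists, which is why the constants
    -- carry `|W|`.
    have hW0 : 0 ≤ W := by linarith [hxD.2]
    rw [hXx, hQx, Set.indicator_of_mem hxB, hκ, abs_of_nonneg hW0]
    refine energy_density_ge (g := ‖gradient u x - gradient v x‖) (K := K) (W := W) hp₁ hp₂ hk hm hR
      (hη0 x) (hη1 x) hwpos (by linarith) (norm_nonneg _) ?_ hε.le hK hA0 hB₂0 hc₀0 hC rfl rfl hlam
      hR₁ hR₂ ?_ ?_ F3 (abs_last_sub_le hxΩ) ?_ ?_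
    · exact (norm_sub_le _ _).trans (by linarith)
    · rw [hu.fderiv_sub_apply hv hxΩ]
      exact F1
    · rw [← Real.norm_eq_abs]
      refine (ContinuousLinearMap.le_opNorm _ _).trans ?_
      exact mul_le_mul (hηd x) F2 (norm_nonneg _) (by positivity)
    · rw [hu.fderiv_sub_apply hv hxΩ]
      refine (abs_real_inner_le_norm _ _).trans ?_
      rw [hen, one_mul]
    · rw [← Real.norm_eq_abs]
      refine (ContinuousLinearMap.le_opNorm _ _).trans ?_
      rw [hen, mul_one]
      exact hηd x
  have iXQ : Integrable fun x => X x + Λ * Q x := iX.add (iQ.const_mul Λ)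
  refine ⟨iΨ, ?_⟩
  calc ∫ x, Ψ x ≤ ∫ x, (X x + Λ * Q x + B.indicator (fun _ => κ) x) :=
        integral_mono iΨ (iXQ.add iκ) hpt
    _ = (∫ x, X x) + Λ * (∫ x, Q x) + κ * volume.real B := by
        rw [integral_add iXQ iκ, integral_add iX (iQ.const_mul Λ),
          integral_const_mul, integral_indicator isClosed_closedBall.measurableSet,
          setIntegral_const, smul_eq_mul, mul_comm (volume.real B)]
    _ ≤ κ * volume.real B := by
        rw [hQint]
        linarith

end Comparison

/-! ### Comparison for differences bounded above -/

section Comparison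

open Metric Filter Topology

variable {n : ℕ} {p q M γ La Lb Lf K lam y₀ : ℝ} {a b f : Pt n → ℝ → ℝ} {I : Set ℝ}
  {u v : Pt n → ℝ} {S : Set (Pt n)}

/-- The volume grows like `R ^ (n + 1)`, one power less than the denominator. -/
lemma tendsto_inv_pow_mul_volume_closedBall (n : ℕ) :
    Tendsto (fun R : ℝ => (R ^ (n + 2))⁻¹ * volume.real (closedBall (0 : Pt n) (2 * R))) atTop
      (𝓝 0) := by
  have h : Tendsto (fun R : ℝ => 2 ^ (n + 1) * volume.real (ball (0 : Pt n) 1) * R⁻¹) atTop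
      (𝓝 0) := by
    simpa using tendsto_inv_atTop_zero.const_mul (2 ^ (n + 1) * volume.real (ball (0 : Pt n) 1))
  refine h.congr' ?_
  filter_upwards [eventually_gt_atTop 0] with R hR
  rw [Measure.addHaar_real_closedBall _ _ (by positivity), finrank_euclideanSpace, Fintype.card_fin]
  field_simp
  ring

/-- Weak comparison in a narrow strip, for bounded `u - v`. -/
theorem le_of_isWeakSub_of_isWeakSuper (hn : 1 ≤ n) (hp₁ : 1 < p) (hp₂ : p < 2) (hq : 1 < q)
    (hM : 0 < M) (hγ : 0 < γ) (hLa : 0 ≤ La) (hLb : 0 ≤ Lb) (hLf : 0 ≤ Lf) (hK : 0 ≤ K)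
    (ha : ContCoeff a) (hb : ContCoeff b) (hf : ContCoeff f) (hst : StructOn a b f I La Lb Lf K)
    (hell : Elliptic a γ) (hy₀ : lam / 2 ≤ y₀) (hu : BddC1 (strip n lam y₀) I M u)
    (hv : BddC1 (strip n lam y₀) I M v) (hsub : IsWeakSub p q a b f (strip n lam y₀) u)
    (hsup : IsWeakSuper p q a b f (strip n lam y₀) v) (hS : IsOpen S)
    (hSΩ : S ⊆ strip n lam y₀) (hfr : ∀ x ∈ frontier S, u x ≤ v x) {W : ℝ}
    (hW : ∀ x ∈ S, u x - v x ≤ W)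
    (hlam : poincareWeight n (La * M ^ (p - 1)) (K * (q * M ^ (q - 1))) (Lb * M ^ q + Lf)
      (γ * ((p - 1) * M ^ (p - 2))) * lam ≤ 1) :
    ∀ x ∈ S, u x ≤ v x := by
  by_contra! hcon
  obtain ⟨x₀, hx₀, hlt⟩ := hcon
  set c := (u x₀ - v x₀) / 2 with hc
  have hc0 : 0 < c := by rw [hc]; linarith
  obtain ⟨r, hr, hball⟩ : ∃ r > 0, ∀ x ∈ ball x₀ r, x ∈ S ∧ c < u x - v x := by
    have hcont : ContinuousAt (fun x => u x - v x) x₀ :=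
      ((hu.diff x₀ (hSΩ hx₀)).sub (hv.diff x₀ (hSΩ hx₀))).continuousAt
    have h1 : ∀ᶠ x in 𝓝 x₀, c < u x - v x :=
      hcont.eventually (lt_mem_nhds (show c < u x₀ - v x₀ by rw [hc]; linarith))
    have h2 : ∀ᶠ x in 𝓝 x₀, x ∈ S := hS.mem_nhds hx₀
    exact Metric.eventually_nhds_iff_ball.mp (h2.and h1)
  have hvol : 0 < volume.real (ball x₀ r) :=
    ENNReal.toReal_pos (measure_ball_pos _ _ hr).ne' measure_ball_lt_top.ne
  -- A lower bound for the energy integral, uniform in `ε ≤ c / 2` and in `R ≥ ‖x₀‖ + r`.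
  set κ := (c / 2) ^ (n + 2) * volume.real (ball x₀ r) with hκ
  have hκ0 : 0 < κ := by positivity
  obtain ⟨k, hk⟩ := exists_nat_ge (1 / (2 - p))
  rw [div_le_iff₀ (by linarith)] at hk
  obtain ⟨m, hm⟩ : ∃ m, m = k * (n + 2) := ⟨_, rfl⟩
  obtain ⟨C, hC, hcut⟩ := exists_cutoff (Pt n)
  have hb0 : 0 < (n + 1) * (γ * ((p - 1) * M ^ (p - 2))) / 2 := by
    have : 0 < p - 1 := by linarith
    positivity
  have hdecay : Tendsto (fun R : ℝ => m * C * (2 * K + (La * M ^ (p - 1) + 1) * W ^ (2 - p)) *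
      R ^ (1 - p)) atTop (𝓝 0) := by
    have := tendsto_rpow_neg_atTop (show 0 < p - 1 by linarith)
    rw [neg_sub] at this
    simpa using this.const_mul (m * C * (2 * K + (La * M ^ (p - 1) + 1) * W ^ (2 - p)))
  obtain ⟨R, hR₁, hR₂, hRv, hR, hRx⟩ := ((hdecay.eventually (ge_mem_nhds hb0)).and
    ((hdecay.eventually (ge_mem_nhds (show (0 : ℝ) < 1 / 2 by norm_num))).and
    (((tendsto_inv_pow_mul_volume_closedBall n).eventually
      (ge_mem_nhds (show 0 < κ / 4 by positivity))).and
    ((eventually_ge_atTop 1).and (eventually_ge_atTop (‖x₀‖ + r)))))).exists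
  obtain ⟨η, hη, hη0, hη1, hηR, hηs, hηd⟩ := hcut R (by linarith)
  set D := (n + 1) * |W| ^ n * (La * M ^ (p - 1)) * (2 * M)
        + |W| ^ (n + 1) * m * C * (La * M ^ (p - 1)) + |W| ^ (n + 1) * (Lb * M ^ q + Lf) with hD
  have hD0 : 0 ≤ D := by positivity
  set V := volume.real (closedBall (0 : Pt n) (2 * R)) with hV
  have hV0 : 0 ≤ V := measureReal_nonneg
  -- `ε` is chosen after `R`, since its coefficient `D * V` depends on `R`. Each of the two error
  -- terms is then at most `κ / 4`, contradicting the lower bound `κ`.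
  obtain ⟨ε, hε, hεc, hεκ⟩ : ∃ ε, 0 < ε ∧ ε ≤ c / 2 ∧ ε * (D * V + 1) ≤ κ / 4 := by
    have hDV : 0 < D * V + 1 := by positivity
    refine ⟨min (c / 2) (κ / 4 / (D * V + 1)), by positivity, min_le_left _ _, ?_⟩
    exact (le_div_iff₀ hDV).mp (min_le_right _ _)
  obtain ⟨hint, hle⟩ := integral_trunc_pow_le hn hp₁ hp₂ hq hM hγ hLa hLb hLf ha hb hf hst hell hy₀
    hu hv hsub hsup hS hSΩ hfr hW hK hlam hk hm hC hR hη hη0 hη1 hηs hηd hR₁ hR₂ hε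
  have hlow : κ ≤ ∫ x, trunc S (fun x => u x - v x) ε x ^ (n + 2) * η x ^ m := by
    have hi : Integrable ((ball x₀ r).indicator fun _ => (c / 2) ^ (n + 2))
        (volume : Measure (Pt n)) :=
      (integrable_indicator_iff measurableSet_ball).mpr
        (integrableOn_const measure_ball_lt_top.ne)
    calc κ = ∫ x, (ball x₀ r).indicator (fun _ => (c / 2) ^ (n + 2)) x := by
          rw [integral_indicator measurableSet_ball, setIntegral_const, smul_eq_mul, mul_comm]
      _ ≤ _ := by
        refine integral_mono hi hint fun x => ?_
        by_cases hx : x ∈ ball x₀ r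
        · obtain ⟨hxS, hxc⟩ := hball x hx
          have hη' : η x = 1 := by
            refine hηR x (mem_ball_zero_iff.mpr ?_)
            have h1 := mem_ball_iff_norm.mp hx
            have h2 := norm_sub_norm_le x x₀
            linarith
          have hw : trunc S (fun x => u x - v x) ε x = u x - v x - ε :=
            trunc_of_mem ⟨hxS, by linarith⟩
          simp only
          rw [Set.indicator_of_mem hx, hη', one_pow, mul_one, hw]
          exact pow_le_pow_left₀ (by positivity) (by linarith) _
        · rw [Set.indicator_of_notMem hx]
          exact mul_nonneg (pow_nonneg (trunc_nonneg x) _) (pow_nonneg (hη0 x) _)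
  rw [← hD, ← hV, add_mul] at hle
  have : ε * (D * V + 1) = ε * D * V + ε := by ring
  linarith

end Comparison

/-! ### From essential bounds to pointwise bounds, and the height bound from the gradient -/

section Reduction

open Metric Filter Topology

variable {n : ℕ}

/-- By continuity the set where the bound fails is open, and an open null set is empty. -/
lemma norm_le_of_supNorm_le {F : Type*} [NormedAddCommGroup F] {Ω : Set (Pt n)} (hΩ : IsOpen Ω)
    {g : Pt n → F} (hg : ContinuousOn g Ω) {M : ℝ} (hM : 0 ≤ M)
    (h : supNorm Ω g ≤ ENNReal.ofReal M) : ∀ x ∈ Ω, ‖g x‖ ≤ M := by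
  have ho : IsOpen (Ω ∩ {x | M < ‖g x‖}) := by
    have := hg.norm.isOpen_inter_preimage hΩ (isOpen_Ioi (a := M))
    exact this
  have hae : ∀ᵐ x ∂(volume.restrict Ω), ‖g x‖ ≤ M := by
    rw [supNorm, eLpNorm_exponent_top] at h
    filter_upwards [ae_le_eLpNormEssSup (f := g) (μ := volume.restrict Ω)] with x hx
    have := hx.trans h
    rwa [← ofReal_norm, ENNReal.ofReal_le_ofReal_iff hM] at this
  rw [ae_restrict_iff' hΩ.measurableSet] at hae
  have hz : volume (Ω ∩ {x | M < ‖g x‖}) = 0 := by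
    refine measure_mono_null (fun x hx => ?_) hae
    exact fun hx' => absurd (hx' hx.1) (not_le.mpr hx.2)
  have he := ho.eq_empty_of_measure_zero hz
  intro x hx
  by_contra hlt
  have : x ∈ Ω ∩ {x | M < ‖g x‖} := ⟨hx, not_le.mp hlt⟩
  rw [he] at this
  exact this

lemma C1HolderLoc.continuousOn_gradient {α : NNReal} {Ω : Set (Pt n)} {u : Pt n → ℝ}
    (hu : C1HolderLoc α Ω u) (hα : 0 < α) (hΩ : IsOpen Ω) : ContinuousOn (gradient u) Ω := by
  intro x hx
  obtain ⟨r, hr, hsub⟩ := nhds_basis_closedBall.mem_iff.mp (hΩ.mem_nhds hx)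
  obtain ⟨C, hC⟩ := hu.holder _ (isCompact_closedBall x r) (hsub.trans subset_closure)
  have h := hC.continuousOn hα
  rw [Set.inter_eq_left.mpr hsub] at h
  exact (h.continuousAt (closedBall_mem_nhds x hr)).continuousWithinAt

lemma C1HolderLoc.bddC1 {α : NNReal} {Ω : Set (Pt n)} {u : Pt n → ℝ} (hu : C1HolderLoc α Ω u)
    (hα : 0 < α) (hΩ : IsOpen Ω) {I : Set ℝ} {M : ℝ} (hM : 0 ≤ M) (hI : ∀ x ∈ Ω, u x ∈ I)
    (h : supNorm Ω (gradient u) ≤ ENNReal.ofReal M) : BddC1 Ω I M u where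
  cont := hu.cont
  diff := hu.diff
  grad_cont := hu.continuousOn_gradient hα hΩ
  mem := hI
  grad_le := norm_le_of_supNorm_le hΩ (hu.continuousOn_gradient hα hΩ) hM h

/-- In a strip of width `lam`, a function with gradient bounded by `C` which is nonpositive on the
boundary of `S` is at most `C * lam` in `S`. -/
lemma sub_le_of_nonpos_frontier {lam y₀ C : ℝ} (hC : 0 ≤ C) {S : Set (Pt n)} (hS : IsOpen S)
    (hSΩ : S ⊆ strip n lam y₀) {d : Pt n → ℝ} (hdc : ContinuousOn d (closure S))
    (hfr : ∀ x ∈ frontier S, d x ≤ 0) (hd : ∀ x ∈ S, DifferentiableAt ℝ d x)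
    (hb : ∀ x ∈ S, ‖fderiv ℝ d x‖ ≤ C) : ∀ x ∈ S, d x ≤ C * lam := by
  intro x hx
  set e : Pt n := EuclideanSpace.single (Fin.last n) 1 with he
  have hen : ‖e‖ = 1 := by simp [he]
  have hline : Continuous fun t : ℝ => x + t • e := by fun_prop
  have hlast : ∀ t : ℝ, (x + t • e) (Fin.last n) = x (Fin.last n) + t := by
    intro t; simp [he]
  have hx1 : y₀ - lam / 2 < x (Fin.last n) := (hSΩ hx).1
  have hx2 : x (Fin.last n) < y₀ + lam / 2 := (hSΩ hx).2
  have hlam : 0 < lam := by linarith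
  have hcomp : IsCompact (Set.Icc 0 lam ∩ (fun t : ℝ => x + t • e) ⁻¹' Sᶜ) :=
    isCompact_Icc.inter_right (hS.isClosed_compl.preimage hline)
  have hne : (Set.Icc 0 lam ∩ (fun t : ℝ => x + t • e) ⁻¹' Sᶜ).Nonempty := by
    refine ⟨lam, ⟨hlam.le, le_rfl⟩, fun h => ?_⟩
    have := (hSΩ h).2
    rw [hlast] at this
    linarith
  -- `T` is the first exit time from `S` along the vertical direction; it is at most `lam` because
  -- the line has left the strip by then.
  obtain ⟨T, ⟨hT, hTS⟩, hmin⟩ := hcomp.exists_isLeast hne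
  have hin : ∀ t ∈ Set.Ico 0 T, x + t • e ∈ S := by
    intro t ht
    by_contra h
    exact absurd (hmin ⟨⟨ht.1, ht.2.le.trans hT.2⟩, h⟩) (not_le.mpr ht.2)
  have hT0 : 0 < T := by
    refine hT.1.lt_of_ne fun h => hTS ?_
    rw [← h]
    simpa using hx
  have hclT : ∀ t ∈ Set.Icc 0 T, x + t • e ∈ closure S := by
    intro t ht
    have h1 : t ∈ closure (Set.Ico 0 T) := by rwa [closure_Ico hT0.ne]
    exact map_mem_closure (f := fun t : ℝ => x + t • e) hline h1 hin
  have hgc : ContinuousOn (fun t : ℝ => d (x + t • e)) (Set.Icc 0 T) :=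
    hdc.comp hline.continuousOn hclT
  have hgd : ∀ t ∈ Set.Ico 0 T, HasDerivWithinAt (fun t : ℝ => d (x + t • e))
      (fderiv ℝ d (x + t • e) e) (Set.Ici t) t := by
    intro t ht
    have h1 : HasDerivAt (fun t : ℝ => x + t • e) e t := by
      simpa using ((hasDerivAt_id t).smul_const e).const_add x
    exact ((hd _ (hin t ht)).hasFDerivAt.comp_hasDerivAt t h1).hasDerivWithinAt
  have hbd : ∀ t ∈ Set.Ico 0 T, ‖fderiv ℝ d (x + t • e) e‖ ≤ C := by
    intro t ht
    refine (ContinuousLinearMap.le_opNorm _ _).trans ?_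
    rw [hen, mul_one]
    exact hb _ (hin t ht)
  have hmv := norm_image_sub_le_of_norm_deriv_right_le_segment hgc hgd hbd T ⟨hT.1, le_rfl⟩
  have hend : d (x + T • e) ≤ 0 :=
    hfr _ ⟨hclT T ⟨hT.1, le_rfl⟩, fun h => hTS (interior_subset h)⟩
  have h0 : d (x + (0 : ℝ) • e) = d x := by simp
  rw [h0, sub_zero, Real.norm_eq_abs] at hmv
  have h1 := neg_le_of_abs_le hmv
  have h2 : C * T ≤ C * lam := mul_le_mul_of_nonneg_left hT.2 hC
  linarith

lemma BddC1.norm_fderiv_sub_le {Ω : Set (Pt n)} {I : Set ℝ} {M : ℝ} {u v : Pt n → ℝ}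
    (hu : BddC1 Ω I M u) (hv : BddC1 Ω I M v) {x : Pt n} (hx : x ∈ Ω) :
    ‖fderiv ℝ (fun x => u x - v x) x‖ ≤ 2 * M := by
  have hM : 0 ≤ M := (norm_nonneg _).trans (hu.grad_le x hx)
  refine ContinuousLinearMap.opNorm_le_bound _ (by positivity) fun z => ?_
  rw [hu.fderiv_sub_apply hv hx, mul_comm]
  refine (norm_inner_le_norm _ _).trans (mul_le_mul_of_nonneg_left ?_ (norm_nonneg _))
  refine (norm_sub_le _ _).trans ?_
  have := hu.grad_le x hx
  have := hv.grad_le x hx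
  linarith

end Reduction

end StripWCP

/-! ### The theorem and its threshold -/

theorem theorem1p6 (n : ℕ) (hn : 2 ≤ n + 1) (p q : ℝ) (hp₁ : 1 < p) (hp₂ : p < 2)
    (hq₁ : 1 < q) (hq₂ : q ≤ p) (M₀ γ La Lb Lf K : ℝ) (hM₀ : 0 < M₀) (hγ : 0 < γ)
    (hLa : 0 < La) (hLb : 0 < Lb) (hLf : 0 < Lf) (hK : 0 < K) :
    (∃ lamBar : ℝ, 0 < lamBar ∧
      ∀ a b f : StripWCP.Pt n → ℝ → ℝ,
        StripWCP.ContCoeff a → StripWCP.ContCoeff b → StripWCP.ContCoeff f →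
        StripWCP.LocStruct a b f →
        StripWCP.StructOn a b f (Set.Icc (-M₀) M₀) La Lb Lf K →
        StripWCP.Elliptic a γ →
      ∀ lam y₀ : ℝ, 0 < lam → lam / 2 ≤ y₀ →
      ∀ (α : NNReal) (u v : StripWCP.Pt n → ℝ), 0 < α → α < 1 →
        StripWCP.C1HolderLoc α (StripWCP.strip n lam y₀) u →
        StripWCP.C1HolderLoc α (StripWCP.strip n lam y₀) v →
        StripWCP.supNorm (StripWCP.strip n lam y₀) u
          + StripWCP.supNorm (StripWCP.strip n lam y₀) (gradient u) ≤ ENNReal.ofReal M₀ →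
        StripWCP.supNorm (StripWCP.strip n lam y₀) v
          + StripWCP.supNorm (StripWCP.strip n lam y₀) (gradient v) ≤ ENNReal.ofReal M₀ →
        StripWCP.IsWeakSub p q a b f (StripWCP.strip n lam y₀) u →
        StripWCP.IsWeakSuper p q a b f (StripWCP.strip n lam y₀) v →
      ∀ S : Set (StripWCP.Pt n), IsOpen S → S ⊆ StripWCP.strip n lam y₀ →
        (∀ x ∈ frontier S, u x ≤ v x) →
        lam < lamBar → ∀ x ∈ S, u x ≤ v x) ∧
    (∃ lamBar : ℝ, 0 < lamBar ∧
      ∀ a b f : StripWCP.Pt n → ℝ → ℝ,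
        StripWCP.ContCoeff a → StripWCP.ContCoeff b → StripWCP.ContCoeff f →
        StripWCP.StructOn a b f Set.univ La Lb Lf K →
        StripWCP.Elliptic a γ →
      ∀ lam y₀ : ℝ, 0 < lam → lam / 2 ≤ y₀ →
      ∀ (α : NNReal) (u v : StripWCP.Pt n → ℝ), 0 < α → α < 1 →
        StripWCP.C1HolderLoc α (StripWCP.strip n lam y₀) u →
        StripWCP.C1HolderLoc α (StripWCP.strip n lam y₀) v →
        StripWCP.supNorm (StripWCP.strip n lam y₀) (gradient u) ≤ ENNReal.ofReal M₀ →
        StripWCP.supNorm (StripWCP.strip n lam y₀) (gradient v) ≤ ENNReal.ofReal M₀ →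
        StripWCP.IsWeakSub p q a b f (StripWCP.strip n lam y₀) u →
        StripWCP.IsWeakSuper p q a b f (StripWCP.strip n lam y₀) v →
      ∀ S : Set (StripWCP.Pt n), IsOpen S → S ⊆ StripWCP.strip n lam y₀ →
        (∀ x ∈ frontier S, u x ≤ v x) →
        lam < lamBar → ∀ x ∈ S, u x ≤ v x) := by
  have hn1 : 1 ≤ n := by omega
  set Λ := StripWCP.poincareWeight n (La * M₀ ^ (p - 1)) (K * (q * M₀ ^ (q - 1)))
    (Lb * M₀ ^ q + Lf) (γ * ((p - 1) * M₀ ^ (p - 2))) with hΛ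
  have hΛ0 : 0 < Λ := by
    have : 0 < p - 1 := by linarith
    rw [hΛ, StripWCP.poincareWeight]
    positivity
  have hsmall : ∀ lam : ℝ, lam < 1 / Λ → Λ * lam ≤ 1 := fun lam h => by
    rw [lt_div_iff₀ hΛ0] at h
    linarith
  -- The same threshold serves both cases: the bound `W` on `u - v` affects only how large `R` must
  -- be and does not enter `Λ`.
  refine ⟨⟨1 / Λ, by positivity, ?_⟩, ⟨1 / Λ, by positivity, ?_⟩⟩
  · intro a b f ha hb hf _ hst hell lam y₀ _ hy₀ α u v hα _ hu hv hbu hbv hsub hsup S hS hSΩ hfr hlt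
    have hΩ : IsOpen (StripWCP.strip n lam y₀) := StripWCP.isOpen_strip
    have hub := StripWCP.norm_le_of_supNorm_le hΩ (hu.cont.mono subset_closure) hM₀.le
      (le_self_add.trans hbu)
    have hvb := StripWCP.norm_le_of_supNorm_le hΩ (hv.cont.mono subset_closure) hM₀.le
      (le_self_add.trans hbv)
    have hu' := hu.bddC1 hα hΩ hM₀.le (I := Set.Icc (-M₀) M₀) (fun x hx => abs_le.mp (hub x hx))
      (le_add_self.trans hbu)
    have hv' := hv.bddC1 hα hΩ hM₀.le (I := Set.Icc (-M₀) M₀) (fun x hx => abs_le.mp (hvb x hx))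
      (le_add_self.trans hbv)
    refine StripWCP.le_of_isWeakSub_of_isWeakSuper (W := 2 * M₀) hn1 hp₁ hp₂ hq₁ hM₀ hγ hLa.le hLb.le
      hLf.le hK.le ha hb hf hst hell hy₀ hu' hv' hsub hsup hS hSΩ hfr (fun x hx => ?_)
      (hsmall lam hlt)
    have h1 := (hu'.mem x (hSΩ hx)).2
    have h2 := (hv'.mem x (hSΩ hx)).1
    linarith
  · intro a b f ha hb hf hst hell lam y₀ _ hy₀ α u v hα _ hu hv hbu hbv hsub hsup S hS hSΩ hfr hlt
    have hΩ : IsOpen (StripWCP.strip n lam y₀) := StripWCP.isOpen_strip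
    have hu' := hu.bddC1 hα hΩ hM₀.le (I := Set.univ) (fun x _ => Set.mem_univ _) hbu
    have hv' := hv.bddC1 hα hΩ hM₀.le (I := Set.univ) (fun x _ => Set.mem_univ _) hbv
    -- Without bounds on `u` and `v`, the gradient bound `2 * M₀` for `u - v`, integrated across the
    -- strip from the frontier of `S`, still bounds `u - v` from above.
    refine StripWCP.le_of_isWeakSub_of_isWeakSuper (W := 2 * M₀ * lam) hn1 hp₁ hp₂ hq₁ hM₀ hγ hLa.le
      hLb.le hLf.le hK.le ha hb hf hst hell hy₀ hu' hv' hsub hsup hS hSΩ hfr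
      (StripWCP.sub_le_of_nonpos_frontier (by positivity) hS hSΩ
        ((hu.cont.mono (closure_mono hSΩ)).sub (hv.cont.mono (closure_mono hSΩ)))
        (fun x hx => sub_nonpos.mpr (hfr x hx))
        (fun x hx => (hu.diff x (hSΩ hx)).sub (hv.diff x (hSΩ hx)))
        (fun x hx => hu'.norm_fderiv_sub_le hv' (hSΩ hx)))
      (hsmall lam hlt)
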